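/- **Spirals.** A *spiral* is a planar curve, parametrized by arc length $s\in[0,S]$, $S>0$, with position $Z(s)\in\mathbb C$, continuous tangent angle $\tau(s)$ on $[0,S]$ and signed curvature $k(s)=\tau'(s)$, such that $k$ is monotonic (not necessarily strictly), not constant and continuous on $(0,S)$ except for finitely many jumps, and the curve does not contain a full circle. The curvature may become infinite at the endpoints. The spiral is *short* if its tangent direction at interior points is never the direction from $Z(S)$ to $Z(0)$. It is *normalized* if $Z(0)=-c$ and $Z(S)=c$ for some $c>0$; then $\kappa(s)=c\,k(s)$ is its normalized curvature. **Biarcs.** Let $\alpha,\beta\in[-\pi,\pi]$ and $\omega=\frac{\alpha+\beta}2$. For $|\xi|<\pi$ let $\mathcal A(\xi)$ be the circular arc (a segment if $\xi=0$) traced from $-1$ to $1$ with tangent angle $\xi$ at $-1$; let $\mathcal A(\pm\pi)$ be the set of real $x$ with $|x|\ge 1$. For $0<b<\infty$ the *biarc* $\mathcal B(b;\alpha,\beta)$ is the curve from $-1$ to $1$ that starts with tangent angle $\alpha$, consists of an arc of constant curvature $-\sin\alpha-b^{-1}\sin\omega$ followed, with continuous tangent, by an arc of constant curvature $\sin\beta+b\sin\omega$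 (neither being a full circle), and ends with tangent direction $\beta$. Further, $\mathcal B(0;\alpha,\beta)=\mathcal A(-\beta)$ and $\mathcal B(\infty;\alpha,\beta)=\mathcal A(\alpha)$. For $0\le b_1\le b_2\le\infty$ the *bilense* $\mathbf B(\alpha,\beta,b_1,b_2)$ is the union of the biarcs $\mathcal B(b;\alpha,\beta)$ with $b_1\le b\le b_2$. **Theorem 7.4.** Let $\alpha,\beta\in[-\pi,\pi]$ with $|\omega|\neq\pi$, and let $\kappa_1,\kappa_2\in[-\infty,\infty]$. Consider any normalized short spiral with $\tau(0)=\alpha$, $\tau(S)=\beta$, and suppose that either its curvature is increasing and $\kappa_1\le\kappa(s)\le\kappa_2$ for $0<s<S$, or its curvature is decreasing and $\kappa_1\ge\kappa(s)\ge\kappa_2$ for $0<s<S$. Put $$b_1=\frac{-\sin\omega}{\kappa_1+\sin\alpha},\qquad b_2=\frac{\kappa_2-\sin\beta}{\sin\omega},$$ where $b_1=0$ if $\kappa_1$ is infinite and $b_2=\infty$ if $\kappa_2$ is infinite. Then $0\le b_1\le b_2\le\infty$, and, after scaling by $1/c$, the spiral is contained in the bilense: $Z(s)/c\in\mathbf B(\alpha,\beta,b_1,b_2)$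 for all $s\in[0,S]$. -/

import Mathlib

namespace SpiralGeometry

/-- The point reached at arc length `s` on the directed curve of constant curvature `κ`
(a circle, or a straight line if `κ = 0`) that starts at `p` with tangent angle `θ`. -/
noncomputable def arcPoint (p : ℂ) (θ κ s : ℝ) : ℂ :=
  p + ∫ t in (0 : ℝ)..s, Complex.exp (((θ + κ * t : ℝ) : ℂ) * Complex.I)

/-- A planar spiral, given by arc length `s ∈ [0, S]`: position `Z`, tangent angle `τ`, signed
curvature `k`. The curvature is monotonic, not constant and continuous up to finitely many jumps
in the open interval `(0, S)`; it may become infinite at the two endpoints, while the tangent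
angle remains continuous up to them. The trace of the curve contains no full circle. -/
structure Spiral where
  /-- total length -/
  S : ℝ
  /-- position -/
  Z : ℝ → ℂ
  /-- tangent angle -/
  τ : ℝ → ℝ
  /-- signed curvature -/
  k : ℝ → ℝ
  S_pos : 0 < S
  continuousOn_Z : ContinuousOn Z (Set.Icc 0 S)
  continuousOn_τ : ContinuousOn τ (Set.Icc 0 S)
  hasDerivAt_Z : ∀ s ∈ Set.Ioo 0 S, HasDerivAt Z (Complex.exp ((τ s : ℂ) * Complex.I)) s
  piecewise : ∃ F : Finset ℝ, ∀ s ∈ Set.Ioo 0 S, s ∉ F →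
    ContinuousAt k s ∧ HasDerivAt τ (k s) s
  monotonic : MonotoneOn k (Set.Ioo 0 S) ∨ AntitoneOn k (Set.Ioo 0 S)
  not_const : ∃ s ∈ Set.Ioo 0 S, ∃ t ∈ Set.Ioo 0 S, k s ≠ k t
  no_circle : ¬ ∃ (p : ℂ) (r : ℝ), 0 < r ∧ Metric.sphere p r ⊆ Z '' Set.Icc 0 S

/-- The curve is short: at no interior point has the tangent the direction from the end point
`Z S` to the start point `Z 0`, opposite to that of the chord. -/
def Spiral.IsShort (C : Spiral) : Prop :=
  ∀ s ∈ Set.Ioo 0 C.S, ∀ r : ℝ, 0 < r →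
    Complex.exp ((C.τ s : ℂ) * Complex.I) ≠ (r : ℂ) * (C.Z 0 - C.Z C.S)

/-- The curve is normalized with half-chord `c`: it goes from `(-c, 0)` to `(c, 0)`. -/
def Spiral.IsNormalized (C : Spiral) (c : ℝ) : Prop :=
  0 < c ∧ C.Z 0 = -(c : ℂ) ∧ C.Z C.S = (c : ℂ)

/-- The curve has increasing curvature (not strictly). -/
def Spiral.IsIncreasing (C : Spiral) : Prop := MonotoneOn C.k (Set.Ioo 0 C.S)

/-- The curve has decreasing curvature (not strictly). -/
def Spiral.IsDecreasing (C : Spiral) : Prop := AntitoneOn C.k (Set.Ioo 0 C.S)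

/-- The circular arc traced from `-1` to `1` with tangent angle `ξ ∈ [-π, π]` at the
start point (its curvature is `-sin ξ`). For `ξ = ±π` the arc passes through infinity and is the
complement of the chord to the infinite straight line (together with `-1` and `1`). -/
noncomputable def circArc (ξ : ℝ) : Set ℂ :=
  {z | (|ξ| = Real.pi ∧ z.im = 0 ∧ 1 ≤ |z.re|) ∨
    (|ξ| ≠ Real.pi ∧ ∃ ℓ : ℝ, 0 < ℓ ∧ |Real.sin ξ| * ℓ < 2 * Real.pi ∧
      arcPoint (-1) ξ (-Real.sin ξ) ℓ = 1 ∧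
      ∃ s ∈ Set.Icc 0 ℓ, z = arcPoint (-1) ξ (-Real.sin ξ) s)}

/-- Half of the sum of the boundary angles. -/
noncomputable def omega (α β : ℝ) : ℝ := (α + β) / 2

/-- The curvature of the first arc of the biarc with parameter `b`. -/
noncomputable def biarcCurv₁ (b α β : ℝ) : ℝ := -Real.sin α - b⁻¹ * Real.sin (omega α β)

/-- The curvature of the second arc of the biarc with parameter `b`. -/
noncomputable def biarcCurv₂ (b α β : ℝ) : ℝ := Real.sin β + b * Real.sin (omega α β)

/-- The points of a biarc with finite nonzero parameter `b`: the curve that starts at `-1` with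
tangent angle `α`, has curvature `biarcCurv₁ b α β` on a length `ℓ₁` and then
`biarcCurv₂ b α β` on a length `ℓ₂`, neither arc being a full circle, and ends at `1` with
the tangent direction `β`. -/
noncomputable def finiteBiarc (b α β : ℝ) : Set ℂ :=
  {z | ∃ ℓ₁ ℓ₂ : ℝ, 0 < ℓ₁ ∧ 0 < ℓ₂ ∧
    |biarcCurv₁ b α β| * ℓ₁ < 2 * Real.pi ∧ |biarcCurv₂ b α β| * ℓ₂ < 2 * Real.pi ∧
    arcPoint (arcPoint (-1) α (biarcCurv₁ b α β) ℓ₁) (α + biarcCurv₁ b α β * ℓ₁)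
      (biarcCurv₂ b α β) ℓ₂ = 1 ∧
    Complex.exp (((α + biarcCurv₁ b α β * ℓ₁ + biarcCurv₂ b α β * ℓ₂ : ℝ) : ℂ) * Complex.I)
      = Complex.exp ((β : ℂ) * Complex.I) ∧
    ((∃ s ∈ Set.Icc 0 ℓ₁, z = arcPoint (-1) α (biarcCurv₁ b α β) s) ∨
      (∃ s ∈ Set.Icc 0 ℓ₂, z = arcPoint (arcPoint (-1) α (biarcCurv₁ b α β) ℓ₁)
        (α + biarcCurv₁ b α β * ℓ₁) (biarcCurv₂ b α β) s))}

open Classical in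
/-- The biarc with parameter `b` on the chord `[-1, 1]`, with boundary angles `α`, `β`. The
limiting members of the family are the circular arcs for `b = 0` and for infinite `b`. -/
noncomputable def biarc (b : EReal) (α β : ℝ) : Set ℂ :=
  if b = 0 then circArc (-β)
  else if b = ⊤ ∨ b = ⊥ then circArc α
  else finiteBiarc b.toReal α β

/-- The bilense: the region filled by the biarcs with parameters from `b₁` to `b₂`,
the two boundary biarcs included. -/
def bilense (α β : ℝ) (b₁ b₂ : EReal) : Set ℂ :=
  {z | ∃ b : EReal, b₁ ≤ b ∧ b ≤ b₂ ∧ z ∈ biarc b α β}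

/-- `b₁ = -sin ω / (κ₁ + sin α)`, which is `0` for infinite `κ₁`. -/
noncomputable def bilenseParam₁ (α β : ℝ) (κ₁ : EReal) : EReal :=
  ((-Real.sin (omega α β) : ℝ) : EReal) / (κ₁ + ((Real.sin α : ℝ) : EReal))

/-- `b₂ = (κ₂ - sin β) / sin ω`, which is infinite for infinite `κ₂`. -/
noncomputable def bilenseParam₂ (α β : ℝ) (κ₂ : EReal) : EReal :=
  (κ₂ - ((Real.sin β : ℝ) : EReal)) / ((Real.sin (omega α β) : ℝ) : EReal)

end SpiralGeometry

/-! A mirror image and a scaling reduce the theorem to increasing curvature and the chord [-1, 1].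
Shortness and |ω| ≠ π keep the tangent angle in (-π, π) at interior points. The driving fact is the
nesting of osculating circles: half the curvature times the power of a fixed point (`osc`) does not
decrease along the curve (`osc_mono`). It is nonnegative for the point -1 and nonpositive for the
point 1. These two signs make the bipolar angle arg w, where w = (1 + z) / (1 - z), strictly
decreasing (`slope_neg`), and it stays strictly between α and -β.

In the w-plane biarcs become simple. The second arc turns into a horizontal ray from b exp(iω) for
the variable exp(iβ) w, and the first arc into a horizontal ray for exp(iα) / w. Put R = |w|, u = α
- arg w and v = arg w + β, so that u, v > 0 and u + v = 2ω. A point with v ≤ ω lies on the biarc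
with b = R sin v / sin ω, a point with u ≤ ω on the one with b = R sin ω / sin u.

It remains to prove b₁ ≤ b ≤ b₂. In each case one bound says that the curve avoids the circle of
extreme curvature tangent to it at an end (`sin_div_distRatio_le`, `distRatio_le`). The other bound
carries such an estimate from the ray u = v = ω to the given point, by the monotonicity of R sin v
(`sin_sq_le`, and `sin_sq_le_end` by reversal). All of this meets in `exists_param`. -/

namespace SpiralGeometry
open Set Filter Topology

/-! ### Monotonicity criteria on an interval. -/

/-- A continuous function whose derivative is nonnegative off a finite set is monotone. -/
theorem le_of_hasDerivAt_nonneg_off_finset {f f' : ℝ → ℝ} (F : Finset ℝ) :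
    ∀ {a b : ℝ}, a ≤ b → ContinuousOn f (Icc a b) →
    (∀ x ∈ Ioo a b, x ∉ F → HasDerivAt f (f' x) x ∧ 0 ≤ f' x) → f a ≤ f b := by
  induction F using Finset.induction_on with
  | empty =>
    intro a b hab hc hd
    have hm : MonotoneOn f (Icc a b) := by
      refine monotoneOn_of_deriv_nonneg (convex_Icc a b) hc ?_ ?_
      · intro x hx
        rw [interior_Icc] at hx
        exact (hd x hx (by simp)).1.differentiableAt.differentiableWithinAt
      · intro x hx
        rw [interior_Icc] at hx
        rw [(hd x hx (by simp)).1.deriv]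
        exact (hd x hx (by simp)).2
    exact hm (left_mem_Icc.2 hab) (right_mem_Icc.2 hab) hab
  | insert p F hp ih =>
    intro a b hab hc hd
    by_cases h : p ∈ Ioo a b
    · refine (ih h.1.le (hc.mono (Icc_subset_Icc_right h.2.le)) fun x hx hxF => ?_).trans
        (ih h.2.le (hc.mono (Icc_subset_Icc_left h.1.le)) fun x hx hxF => ?_)
      · exact hd x ⟨hx.1, hx.2.trans h.2⟩ (by simp [hx.2.ne, hxF])
      · exact hd x ⟨h.1.trans hx.1, hx.2⟩ (by simp [hx.1.ne', hxF])
    · refine ih hab hc fun x hx hxF => hd x hx ?_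
      simp only [Finset.mem_insert, not_or]
      exact ⟨fun e => h (e ▸ hx), hxF⟩

/-- Each bisection halves the total error: the increments of k telescope while the lengths are
halved. This serves in place of differentiating f, which may jump together with k. -/
theorem le_of_sub_ge_mul {f k : ℝ → ℝ} {M x y : ℝ} (hxy : x ≤ y)
    (h : ∀ s t, x ≤ s → s ≤ t → t ≤ y → -(M * (k t - k s) * (t - s)) ≤ f t - f s) :
    f x ≤ f y := by
  have key : ∀ n : ℕ, ∀ s t, x ≤ s → s ≤ t → t ≤ y →
      -(M * (k t - k s) * (t - s)) * (1 / 2) ^ n ≤ f t - f s := by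
    intro n
    induction n with
    | zero => intro s t h1 h2 h3; simpa using h s t h1 h2 h3
    | succ n ih =>
      intro s t h1 h2 h3
      have e1 := ih s ((s + t) / 2) h1 (by linarith) (by linarith)
      have e2 := ih ((s + t) / 2) t (by linarith) (by linarith) h3
      have : -(M * (k t - k s) * (t - s)) * (1 / 2) ^ (n + 1) =
        -(M * (k ((s + t) / 2) - k s) * ((s + t) / 2 - s)) * (1 / 2) ^ n +
        -(M * (k t - k ((s + t) / 2)) * (t - (s + t) / 2)) * (1 / 2) ^ n := by ring
      linarith
  have lim : Tendsto (fun n : ℕ => -(M * (k y - k x) * (y - x)) * (1 / 2 : ℝ) ^ n) atTop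
      (𝓝 (-(M * (k y - k x) * (y - x)) * 0)) :=
    (tendsto_pow_atTop_nhds_zero_of_lt_one (by norm_num) (by norm_num)).const_mul _
  rw [mul_zero] at lim
  have := le_of_tendsto' lim fun n => key n x y le_rfl hxy le_rfl
  linarith

/-! ### Curves of increasing curvature and the powers of points in their osculating circles. -/

/-- A curve of increasing curvature from `-1` to `1`, parametrized by arc length, whose tangent
angle lies in `(-π, π)` at interior points. -/
structure IsShortIncreasing (S : ℝ) (Z : ℝ → ℂ) (τ k : ℝ → ℝ) : Prop where
  S_pos : 0 < S
  contZ : ContinuousOn Z (Icc 0 S)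
  contτ : ContinuousOn τ (Icc 0 S)
  derivZ : ∀ s ∈ Ioo 0 S, HasDerivAt Z (Complex.exp ((τ s : ℂ) * Complex.I)) s
  derivτ : ∃ F : Finset ℝ, ∀ s ∈ Ioo 0 S, s ∉ F → HasDerivAt τ (k s) s
  mono : MonotoneOn k (Ioo 0 S)
  not_const : ∃ s ∈ Ioo 0 S, ∃ t ∈ Ioo 0 S, k s ≠ k t
  Z_zero : Z 0 = -1
  Z_end : Z S = 1
  τ_mem : ∀ s ∈ Ioo 0 S, τ s ∈ Ioo (-Real.pi) Real.pi

/-- The power of the point `p + q i` with respect to the osculating circle at `s`, multiplied by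
half of the curvature; it vanishes when the circle passes through the point. -/
noncomputable def osc (Z : ℝ → ℂ) (τ k : ℝ → ℝ) (p q s : ℝ) : ℝ :=
  k s * ((((Z s).re - p) ^ 2 + ((Z s).im - q) ^ 2) / 2) +
    (Real.cos (τ s) * ((Z s).im - q) - Real.sin (τ s) * ((Z s).re - p))

namespace IsShortIncreasing

variable {S : ℝ} {Z : ℝ → ℂ} {τ k : ℝ → ℝ}

/-- The point reflection z ↦ -z together with a reversal of direction keeps the tangent angle and
negates the curvature, which therefore still increases. Facts about the start thus become facts
about the end. -/
theorem reverse (h : IsShortIncreasing S Z τ k) :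
    IsShortIncreasing S (fun s => -Z (S - s)) (fun s => τ (S - s)) (fun s => -k (S - s)) := by
  have hI : ∀ s ∈ Ioo 0 S, S - s ∈ Ioo 0 S := fun s hs => ⟨by linarith [hs.2], by linarith [hs.1]⟩
  have hM : MapsTo (fun s => S - s) (Icc 0 S) (Icc 0 S) :=
    fun s hs => ⟨by linarith [hs.2], by linarith [hs.1]⟩
  have hsub : ∀ s : ℝ, HasDerivAt (fun s => S - s) (-1) s := fun s => by
    simpa using (hasDerivAt_id s).const_sub S
  refine ⟨h.S_pos, ?_, ?_, ?_, ?_, ?_, ?_, ?_, ?_, fun s hs => h.τ_mem _ (hI s hs)⟩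
  · exact (h.contZ.comp (by fun_prop) hM).neg
  · exact h.contτ.comp (by fun_prop) hM
  · intro s hs
    exact ((h.derivZ _ (hI s hs)).scomp s (hsub s)).neg.congr_deriv (by simp)
  · obtain ⟨F, hF⟩ := h.derivτ
    refine ⟨F.image (fun s => S - s), fun s hs hsF => ?_⟩
    have : S - s ∉ F := fun hm => hsF (Finset.mem_image.2 ⟨S - s, hm, by ring⟩)
    have := (hF _ (hI s hs) this).comp s (hsub s)
    simpa [Function.comp_def] using this
  · intro s hs t ht hst
    exact neg_le_neg (h.mono (hI t ht) (hI s hs) (by linarith))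
  · obtain ⟨s, hs, t, ht, hne⟩ := h.not_const
    exact ⟨S - s, hI s hs, S - t, hI t ht, by simpa using hne⟩
  · simp [h.Z_end]
  · simp [h.Z_zero]

theorem osc_reverse (p q s : ℝ) :
    osc (fun s => -Z (S - s)) (fun s => τ (S - s)) (fun s => -k (S - s)) p q s =
      -osc Z τ k (-p) (-q) (S - s) := by
  simp only [osc, Complex.neg_re, Complex.neg_im]
  ring

theorem deriv_re (h : IsShortIncreasing S Z τ k) {s : ℝ} (hs : s ∈ Ioo 0 S) :
    HasDerivAt (fun s => (Z s).re) (Real.cos (τ s)) s := by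
  have := Complex.reCLM.hasFDerivAt.comp_hasDerivAt s (h.derivZ s hs)
  simpa [Function.comp_def, Complex.exp_ofReal_mul_I_re] using this

theorem deriv_im (h : IsShortIncreasing S Z τ k) {s : ℝ} (hs : s ∈ Ioo 0 S) :
    HasDerivAt (fun s => (Z s).im) (Real.sin (τ s)) s := by
  have := Complex.imCLM.hasFDerivAt.comp_hasDerivAt s (h.derivZ s hs)
  simpa [Function.comp_def, Complex.exp_ofReal_mul_I_im] using this

theorem cont_re (h : IsShortIncreasing S Z τ k) : ContinuousOn (fun s => (Z s).re) (Icc 0 S) :=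
  Complex.continuous_re.comp_continuousOn h.contZ

theorem cont_im (h : IsShortIncreasing S Z τ k) : ContinuousOn (fun s => (Z s).im) (Icc 0 S) :=
  Complex.continuous_im.comp_continuousOn h.contZ

theorem τ_sub_le (h : IsShortIncreasing S Z τ k) {a b κ : ℝ} (ha : 0 ≤ a) (hab : a ≤ b)
    (hb : b ≤ S) (hk : ∀ x ∈ Ioo a b, k x ≤ κ) : τ b - τ a ≤ κ * (b - a) := by
  obtain ⟨F, hF⟩ := h.derivτ
  have hs : Icc a b ⊆ Icc 0 S := Icc_subset_Icc ha hb
  have := le_of_hasDerivAt_nonneg_off_finset (f := fun x => κ * x - τ x)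
    (f' := fun x => κ - k x) F hab
    ((continuous_const.mul continuous_id).continuousOn.sub (h.contτ.mono hs)) (by
      intro x hx hxF
      refine ⟨?_, by linarith [hk x hx]⟩
      exact (((hasDerivAt_id x).const_mul κ).sub
        (hF x ⟨ha.trans_lt hx.1, hx.2.trans_le hb⟩ hxF)).congr_deriv (by simp))
  linarith

theorem le_τ_sub (h : IsShortIncreasing S Z τ k) {a b κ : ℝ} (ha : 0 ≤ a) (hab : a ≤ b)
    (hb : b ≤ S) (hk : ∀ x ∈ Ioo a b, κ ≤ k x) : κ * (b - a) ≤ τ b - τ a := by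
  have := h.reverse.τ_sub_le (a := S - b) (b := S - a) (κ := -κ) (by linarith) (by linarith)
    (by linarith) (fun x hx => neg_le_neg (hk (S - x) ⟨by linarith [hx.2], by linarith [hx.1]⟩))
  simp only [sub_sub_cancel] at this
  linarith

/-- Formally d(osc) = ½|Z - P|² dk, since the remaining terms cancel by τ' = k. As k may jump, this
is proved up to an error of second order and finished by `le_of_sub_ge_mul`. -/
theorem osc_sub_ge (h : IsShortIncreasing S Z τ k) (p q : ℝ) {x y m : ℝ} (hx : 0 < x)
    (hxy : x ≤ y) (hy : y < S)
    (hm : ∀ t ∈ Icc x y, m ≤ (((Z t).re - p) ^ 2 + ((Z t).im - q) ^ 2) / 2) :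
    m * (k y - k x) ≤ osc Z τ k p q y - osc Z τ k p q x := by
  obtain ⟨F, hF⟩ := h.derivτ
  have hcr : ContinuousOn (fun t => (Z t).re - p) (Icc 0 S) := h.cont_re.sub continuousOn_const
  have hci : ContinuousOn (fun t => (Z t).im - q) (Icc 0 S) := h.cont_im.sub continuousOn_const
  have hcc : ContinuousOn (fun t => Real.cos (τ t)) (Icc 0 S) :=
    Real.continuous_cos.comp_continuousOn h.contτ
  have hcs : ContinuousOn (fun t => Real.sin (τ t)) (Icc 0 S) :=
    Real.continuous_sin.comp_continuousOn h.contτ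
  obtain ⟨M, hM⟩ := isCompact_Icc.exists_bound_of_continuousOn ((hcc.mul hcr).add (hcs.mul hci))
  have hI : ∀ t, x ≤ t → t ≤ y → t ∈ Ioo 0 S :=
    fun t h1 h2 => ⟨hx.trans_le h1, h2.trans_lt hy⟩
  have key := le_of_sub_ge_mul (f := fun t => osc Z τ k p q t - m * k t) (k := k) (M := M) hxy (by
    intro s t h1 h2 h3
    have hk := h.mono (hI s h1 (h2.trans h3)) (hI t (h1.trans h2) h3) h2
    have hsub : Icc s t ⊆ Icc 0 S := Icc_subset_Icc (hx.le.trans h1) (h3.trans hy.le)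
    -- With the curvature frozen at k t, the derivative of the power term is (k t - k u)⟨Z u - P,
    -- exp(iτ u)⟩ ≥ -M (k t - k s). Replacing k t by k s at the left end then yields the main term.
    have := le_of_hasDerivAt_nonneg_off_finset
      (f := fun u => k t * ((((Z u).re - p) ^ 2 + ((Z u).im - q) ^ 2) / 2) +
        (Real.cos (τ u) * ((Z u).im - q) - Real.sin (τ u) * ((Z u).re - p)) +
        M * (k t - k s) * u)
      (f' := fun u => (k t - k u) * (Real.cos (τ u) * ((Z u).re - p) +
        Real.sin (τ u) * ((Z u).im - q)) + M * (k t - k s)) F h2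
      ((((continuousOn_const.mul (((hcr.pow 2).add (hci.pow 2)).div_const 2)).add
        ((hcc.mul hci).sub (hcs.mul hcr))).add
        (continuousOn_const.mul continuousOn_id)).mono hsub) (by
        intro u hu huF
        have huI := hI u (h1.trans hu.1.le) (hu.2.le.trans h3)
        have hr := (h.deriv_re huI).sub_const p
        have hi := (h.deriv_im huI).sub_const q
        have ht := hF u huI huF
        constructor
        · have := (((((hr.pow 2).add (hi.pow 2)).div_const 2).const_mul (k t)).add
            ((ht.cos.mul hi).sub (ht.sin.mul hr))).add ((hasDerivAt_id u).const_mul (M * (k t - k s)))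
          refine this.congr_deriv ?_
          simp only [Nat.cast_ofNat]
          have := Real.sin_sq_add_cos_sq (τ u)
          ring_nf
        · have hb := hM u ⟨huI.1.le, huI.2.le⟩
          simp only [Real.norm_eq_abs, Pi.add_apply, Pi.mul_apply] at hb
          have hb' := neg_le_of_abs_le hb
          have k1 := h.mono huI (hI t (h1.trans h2) h3) hu.2.le
          have k2 := h.mono (hI s h1 (h2.trans h3)) huI hu.1.le
          have M0 : 0 ≤ M := (abs_nonneg _).trans hb
          nlinarith [mul_le_mul_of_nonneg_left hb' (sub_nonneg.2 k1),
            mul_le_mul_of_nonneg_left k2 M0])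
    have hms := hm s ⟨h1, h2.trans h3⟩
    simp only [osc] at this ⊢
    nlinarith [mul_nonneg (sub_nonneg.2 hk) (sub_nonneg.2 hms)])
  linarith

theorem osc_mono (h : IsShortIncreasing S Z τ k) (p q : ℝ) :
    MonotoneOn (osc Z τ k p q) (Ioo 0 S) := by
  intro x hx y hy hxy
  have := h.osc_sub_ge p q hx.1 hxy hy.2 (m := 0) (fun t _ => by positivity)
  linarith

theorem τ_mem_Icc (h : IsShortIncreasing S Z τ k) {s : ℝ} (hs : s ∈ Icc 0 S) :
    τ s ∈ Icc (-Real.pi) Real.pi := by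
  have hm : MapsTo τ (Ioo 0 S) (Icc (-Real.pi) Real.pi) :=
    fun x hx => Ioo_subset_Icc_self (h.τ_mem x hx)
  have hcl : closure (Ioo 0 S) = Icc 0 S := closure_Ioo h.S_pos.ne
  have := hm.closure_of_continuousOn (by rw [hcl]; exact h.contτ)
  rw [hcl, isClosed_Icc.closure_eq] at this
  exact this hs

theorem abs_re_add_one_le (h : IsShortIncreasing S Z τ k) {s : ℝ} (h0 : 0 ≤ s) (hS : s ≤ S) :
    |(Z s).re + 1| ≤ s := by
  have hsub : Icc 0 s ⊆ Icc 0 S := Icc_subset_Icc_right hS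
  have key : ∀ ε : ℝ, |ε| = 1 → ε * ((Z s).re + 1) ≤ s := by
    intro ε hε
    have := le_of_hasDerivAt_nonneg_off_finset (f := fun u => u - ε * (Z u).re)
      (f' := fun u => 1 - ε * Real.cos (τ u)) ∅ h0
      (continuousOn_id.sub (continuousOn_const.mul (h.cont_re.mono hsub))) (fun u hu _ =>
        ⟨(hasDerivAt_id u).sub ((h.deriv_re ⟨hu.1, hu.2.trans_le hS⟩).const_mul ε), by
          have : |ε * Real.cos (τ u)| ≤ 1 := by
            rw [abs_mul, hε, one_mul]; exact Real.abs_cos_le_one _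
          linarith [le_of_abs_le this]⟩)
    simp only [h.Z_zero, Complex.neg_re, Complex.one_re] at this
    linarith
  have := key 1 (by simp)
  have := key (-1) (by simp)
  rw [abs_le]
  constructor <;> linarith

theorem abs_im_le (h : IsShortIncreasing S Z τ k) {s : ℝ} (h0 : 0 ≤ s) (hS : s ≤ S) :
    |(Z s).im| ≤ s := by
  have hsub : Icc 0 s ⊆ Icc 0 S := Icc_subset_Icc_right hS
  have key : ∀ ε : ℝ, |ε| = 1 → ε * (Z s).im ≤ s := by
    intro ε hε
    have := le_of_hasDerivAt_nonneg_off_finset (f := fun u => u - ε * (Z u).im)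
      (f' := fun u => 1 - ε * Real.sin (τ u)) ∅ h0
      (continuousOn_id.sub (continuousOn_const.mul (h.cont_im.mono hsub))) (fun u hu _ =>
        ⟨(hasDerivAt_id u).sub ((h.deriv_im ⟨hu.1, hu.2.trans_le hS⟩).const_mul ε), by
          have : |ε * Real.sin (τ u)| ≤ 1 := by
            rw [abs_mul, hε, one_mul]; exact Real.abs_sin_le_one _
          linarith [le_of_abs_le this]⟩)
    simp only [h.Z_zero, Complex.neg_im, Complex.one_im] at this
    linarith
  have := key 1 (by simp)
  have := key (-1) (by simp)
  rw [abs_le]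
  constructor <;> linarith

/-- The curvature may tend to -∞ at the start, but k s · s ≥ τ s - τ 0 ≥ -2π, because k ≤ k s before
s. Half the squared distance to -1 is at most s², which gives 2π s; the two remaining terms give s
each. -/
theorem osc_start_ge (h : IsShortIncreasing S Z τ k) {s : ℝ} (hs : s ∈ Ioo 0 S) :
    -((2 * Real.pi + 2) * s) ≤ osc Z τ k (-1) 0 s := by
  have hx := h.abs_re_add_one_le hs.1.le hs.2.le
  have hy := h.abs_im_le hs.1.le hs.2.le
  have hτ := h.τ_sub_le (κ := k s) le_rfl hs.1.le hs.2.le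
    (fun x hx => h.mono ⟨hx.1, hx.2.trans hs.2⟩ hs hx.2.le)
  have t0 := h.τ_mem_Icc (left_mem_Icc.2 h.S_pos.le)
  have t1 := h.τ_mem s hs
  have hks : -(2 * Real.pi) ≤ k s * s := by linarith [t0.2, t1.1]
  simp only [osc, sub_neg_eq_add, sub_zero]
  have hx2 : ((Z s).re + 1) ^ 2 ≤ s ^ 2 := sq_le_sq' (neg_le_of_abs_le hx) (le_of_abs_le hx)
  have hy2 : (Z s).im ^ 2 ≤ s ^ 2 := sq_le_sq' (neg_le_of_abs_le hy) (le_of_abs_le hy)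
  have e1 : -(2 * Real.pi * s) ≤ k s * ((((Z s).re + 1) ^ 2 + (Z s).im ^ 2) / 2) := by
    have p0 : 0 ≤ 2 * Real.pi * s := by have := Real.pi_pos; have := hs.1; positivity
    rcases le_total 0 (k s) with hk | hk
    · have : 0 ≤ k s * ((((Z s).re + 1) ^ 2 + (Z s).im ^ 2) / 2) := by positivity
      linarith
    · have : k s * s ^ 2 ≤ k s * ((((Z s).re + 1) ^ 2 + (Z s).im ^ 2) / 2) :=
        mul_le_mul_of_nonpos_left (by linarith) hk
      nlinarith [mul_le_mul_of_nonneg_right hks hs.1.le]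
  have e2 : |Real.cos (τ s) * (Z s).im| ≤ s := by
    rw [abs_mul]
    calc _ ≤ 1 * s := mul_le_mul (Real.abs_cos_le_one _) hy (abs_nonneg _) zero_le_one
      _ = s := one_mul s
  have e3 : |Real.sin (τ s) * ((Z s).re + 1)| ≤ s := by
    rw [abs_mul]
    calc _ ≤ 1 * s := mul_le_mul (Real.abs_sin_le_one _) hx (abs_nonneg _) zero_le_one
      _ = s := one_mul s
  linarith [neg_le_of_abs_le e2, le_of_abs_le e3]

theorem osc_start_nonneg (h : IsShortIncreasing S Z τ k) {s : ℝ} (hs : s ∈ Ioo 0 S) :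
    0 ≤ osc Z τ k (-1) 0 s := by
  refine le_of_forall_pos_le_add fun ε hε => ?_
  have hC : 0 < 2 * Real.pi + 2 := by have := Real.pi_pos; positivity
  set x := min s (ε / (2 * Real.pi + 2)) with hx
  have hx0 : 0 < x := lt_min hs.1 (by positivity)
  have hxs : x ≤ s := min_le_left _ _
  have hxI : x ∈ Ioo 0 S := ⟨hx0, hxs.trans_lt hs.2⟩
  have h1 := h.osc_start_ge hxI
  have h2 := h.osc_mono (-1) 0 hxI hs hxs
  have h3 : (2 * Real.pi + 2) * x ≤ ε := by
    have := mul_le_mul_of_nonneg_left (min_le_right s (ε / (2 * Real.pi + 2))) hC.le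
    rwa [mul_div_cancel₀ _ hC.ne'] at this
  linarith

theorem osc_end_nonpos (h : IsShortIncreasing S Z τ k) {s : ℝ} (hs : s ∈ Ioo 0 S) :
    osc Z τ k 1 0 s ≤ 0 := by
  have := h.reverse.osc_start_nonneg (s := S - s) ⟨by linarith [hs.2], by linarith [hs.1]⟩
  rw [osc_reverse] at this
  simpa using this

/-- The equality case of monotonicity: away from P the squared distance has a positive minimum, so
any growth of k would force growth of `osc`. -/
theorem k_eq_of_osc_eq (h : IsShortIncreasing S Z τ k) (p q : ℝ) {x y : ℝ} (hx : 0 < x)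
    (hxy : x ≤ y) (hy : y < S) (ho : osc Z τ k p q y ≤ osc Z τ k p q x)
    (hne : ∀ t ∈ Icc x y, Z t ≠ ⟨p, q⟩) : k x = k y := by
  have hsub : Icc x y ⊆ Icc 0 S := Icc_subset_Icc hx.le hy.le
  have hc : ContinuousOn (fun t => (((Z t).re - p) ^ 2 + ((Z t).im - q) ^ 2) / 2) (Icc x y) :=
    (((h.cont_re.sub continuousOn_const).pow 2).add
      ((h.cont_im.sub continuousOn_const).pow 2)).div_const 2 |>.mono hsub
  obtain ⟨t, ht, hmin⟩ := isCompact_Icc.exists_isMinOn (nonempty_Icc.2 hxy) hc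
  have hpos : 0 < (((Z t).re - p) ^ 2 + ((Z t).im - q) ^ 2) / 2 := by
    have : (Z t).re - p ≠ 0 ∨ (Z t).im - q ≠ 0 := by
      by_contra! hcon
      exact hne t ht (Complex.ext (by simpa using sub_eq_zero.1 hcon.1)
        (by simpa using sub_eq_zero.1 hcon.2))
    rcases this with hh | hh <;> positivity
  have := h.osc_sub_ge p q hx hxy hy (fun u hu => hmin hu)
  have hk := h.mono ⟨hx, hxy.trans_lt hy⟩ ⟨hx.trans_le hxy, hy⟩ hxy
  nlinarith

/-! ### Chords near the start; the curve does not return to its ends. -/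

/-- Rolle's theorem for the component normal to the chord yields a parallel tangent. The mean value
theorem along that tangent, with turning below π/2, fixes its sense. -/
theorem chord_dir (h : IsShortIncreasing S Z τ k) {s : ℝ} (h0 : 0 < s) (hS : s ≤ S)
    (hτ : ∀ x ∈ Ioo 0 s, ∀ y ∈ Ioo 0 s, |τ x - τ y| < Real.pi / 2) :
    ∃ ξ ∈ Ioo 0 s, ∃ r : ℝ, 0 < r ∧ (Z s).re + 1 = r * Real.cos (τ ξ) ∧
      (Z s).im = r * Real.sin (τ ξ) := by
  have hsub : Icc 0 s ⊆ Icc 0 S := Icc_subset_Icc_right hS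
  have hI : ∀ x ∈ Ioo 0 s, x ∈ Ioo 0 S := fun x hx => ⟨hx.1, hx.2.trans_le hS⟩
  obtain ⟨ξ, hξ, h1⟩ := exists_hasDerivAt_eq_zero
    (f := fun u => ((Z s).re + 1) * (Z u).im - (Z s).im * ((Z u).re + 1))
    (f' := fun u => ((Z s).re + 1) * Real.sin (τ u) - (Z s).im * Real.cos (τ u)) h0
    ((continuousOn_const.mul (h.cont_im.mono hsub)).sub
      (continuousOn_const.mul ((h.cont_re.mono hsub).add continuousOn_const)))
    (by simp [h.Z_zero, mul_comm])
    (fun u hu => ((h.deriv_im (hI u hu)).const_mul _).sub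
      (((h.deriv_re (hI u hu)).add_const 1).const_mul _))
  obtain ⟨η, hη, h2⟩ := exists_hasDerivAt_eq_slope
    (fun u => Real.cos (τ ξ) * (Z u).re + Real.sin (τ ξ) * (Z u).im)
    (fun u => Real.cos (τ ξ) * Real.cos (τ u) + Real.sin (τ ξ) * Real.sin (τ u)) h0
    ((continuousOn_const.mul (h.cont_re.mono hsub)).add
      (continuousOn_const.mul (h.cont_im.mono hsub)))
    (fun u hu => ((h.deriv_re (hI u hu)).const_mul _).add ((h.deriv_im (hI u hu)).const_mul _))
  rw [← Real.cos_sub, eq_div_iff (by linarith)] at h2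
  have hc : 0 < Real.cos (τ ξ - τ η) :=
    Real.cos_pos_of_mem_Ioo (abs_lt.1 (hτ ξ hξ η hη) |> fun h => ⟨h.1, h.2⟩)
  simp only [h.Z_zero, Complex.neg_re, Complex.neg_im, Complex.one_re, Complex.one_im] at h2
  refine ⟨ξ, hξ, Real.cos (τ ξ - τ η) * s, by positivity, ?_, ?_⟩
  · have := Real.sin_sq_add_cos_sq (τ ξ)
    linear_combination (((Z s).re + 1)) * (-this) - Real.cos (τ ξ) * h2 + Real.sin (τ ξ) * h1
  · have := Real.sin_sq_add_cos_sq (τ ξ)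
    linear_combination (Z s).im * (-this) - Real.sin (τ ξ) * h2 - Real.cos (τ ξ) * h1

theorem exists_chord_dir (h : IsShortIncreasing S Z τ k) :
    ∃ δ : ℝ, 0 < δ ∧ δ ≤ S ∧ ∀ s ∈ Ioo 0 δ, ∃ ξ ∈ Ioo 0 s, ∃ r : ℝ, 0 < r ∧
      (Z s).re + 1 = r * Real.cos (τ ξ) ∧ (Z s).im = r * Real.sin (τ ξ) := by
  obtain ⟨δ, hδ, hd⟩ := Metric.continuousOn_iff.1 h.contτ 0 (left_mem_Icc.2 h.S_pos.le)
    (Real.pi / 4) (by have := Real.pi_pos; positivity)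
  refine ⟨min δ S, lt_min hδ h.S_pos, min_le_right _ _, fun s hs => ?_⟩
  have hsS : s ≤ S := hs.2.le.trans (min_le_right _ _)
  refine h.chord_dir hs.1 hsS ?_
  have key : ∀ x ∈ Ioo 0 s, |τ x - τ 0| < Real.pi / 4 := by
    intro x hx
    have := hd x ⟨hx.1.le, hx.2.le.trans hsS⟩ (by
      rw [Real.dist_eq, sub_zero, abs_of_pos hx.1]
      exact hx.2.trans (hs.2.trans_le (min_le_left _ _)))
    rwa [Real.dist_eq] at this
  intro x hx y hy
  have h1 := abs_lt.1 (key x hx)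
  have h2 := abs_lt.1 (key y hy)
  rw [abs_lt]
  constructor <;> linarith [h1.1, h1.2, h2.1, h2.2]

/-- A circular arc that turns by less than a full angle does not return to its start point. -/
theorem ne_of_k_const (h : IsShortIncreasing S Z τ k) {t κ : ℝ} (ht : t ∈ Ioo 0 S)
    (hk : ∀ x ∈ Ioo 0 t, k x = κ) : Z t ≠ -1 := by
  intro hZ
  have hτ : ∀ u ∈ Icc 0 t, τ u = τ 0 + κ * u := by
    intro u hu
    have h1 := h.τ_sub_le (a := 0) (b := u) (κ := κ) le_rfl hu.1 (hu.2.trans ht.2.le)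
      (fun x hx => (hk x ⟨hx.1, hx.2.trans_le hu.2⟩).le)
    have h2 := h.le_τ_sub (a := 0) (b := u) (κ := κ) le_rfl hu.1 (hu.2.trans ht.2.le)
      (fun x hx => (hk x ⟨hx.1, hx.2.trans_le hu.2⟩).ge)
    linarith
  have hsub : Icc 0 t ⊆ Icc 0 S := Icc_subset_Icc_right ht.2.le
  have hI : ∀ x ∈ Ioo 0 t, x ∈ Ioo 0 S := fun x hx => ⟨hx.1, hx.2.trans ht.2⟩
  have hd : ∀ u, HasDerivAt (fun u => τ 0 + κ * u) κ u := fun u => by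
    simpa using ((hasDerivAt_id u).const_mul κ).const_add (τ 0)
  obtain ⟨η, hη, e1⟩ := exists_hasDerivAt_eq_slope
    (fun u => κ * (Z u).re - Real.sin (τ 0 + κ * u))
    (fun u => κ * Real.cos (τ u) - Real.cos (τ 0 + κ * u) * κ) ht.1
    ((continuousOn_const.mul (h.cont_re.mono hsub)).sub (by fun_prop))
    (fun u hu => ((h.deriv_re (hI u hu)).const_mul κ).sub (hd u).sin)
  obtain ⟨η', hη', e2⟩ := exists_hasDerivAt_eq_slope
    (fun u => κ * (Z u).im + Real.cos (τ 0 + κ * u))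
    (fun u => κ * Real.sin (τ u) + -Real.sin (τ 0 + κ * u) * κ) ht.1
    ((continuousOn_const.mul (h.cont_im.mono hsub)).add (by fun_prop))
    (fun u hu => ((h.deriv_im (hI u hu)).const_mul κ).add (hd u).cos)
  have htz : t - 0 ≠ 0 := by linarith [ht.1]
  rw [eq_div_iff htz, hτ η (Ioo_subset_Icc_self hη)] at e1
  rw [eq_div_iff htz, hτ η' (Ioo_subset_Icc_self hη')] at e2
  simp only [hZ, h.Z_zero, mul_zero, add_zero] at e1 e2
  have hs : Real.sin (τ 0 + κ * t) = Real.sin (τ 0) := by linarith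
  have hc : Real.cos (τ 0 + κ * t) = Real.cos (τ 0) := by linarith
  have h1 : Real.cos (κ * t) = 1 := by
    have : κ * t = (τ 0 + κ * t) - τ 0 := by ring
    rw [this, Real.cos_sub, hs, hc]
    have := Real.sin_sq_add_cos_sq (τ 0)
    linarith
  have hb := hτ t (right_mem_Icc.2 ht.1.le)
  have t0 := h.τ_mem_Icc (left_mem_Icc.2 h.S_pos.le)
  have t1 := h.τ_mem t ht
  -- τ 0 may equal ±π but τ t may not, hence |κ t| < 2π and a full turn is excluded. The case κ = 0
  -- that remains is a segment.
  have h0 : κ * t = 0 := (Real.cos_eq_one_iff_of_lt_of_lt (by linarith [t0.2, t1.1])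
    (by linarith [t0.1, t1.2])).1 h1
  have hκ : κ = 0 := (mul_eq_zero.1 h0).resolve_right ht.1.ne'
  subst hκ
  obtain ⟨ξ, hξ, r, hr, e3, e4⟩ := h.chord_dir ht.1 ht.2.le (fun x hx y hy => by
    rw [hτ x (Ioo_subset_Icc_self hx), hτ y (Ioo_subset_Icc_self hy)]
    simp [Real.pi_pos])
  rw [hZ] at e3 e4
  simp only [Complex.neg_re, Complex.neg_im, Complex.one_re, Complex.one_im] at e3 e4
  have := Real.sin_sq_add_cos_sq (τ ξ)
  have : r = 0 := by
    linear_combination r * (-this) - Real.cos (τ ξ) * e3 - Real.sin (τ ξ) * e4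
  exact hr.ne' this

/-- Chord directions exclude a return near the start, so there would be a first return t. There
`osc` for the point -1 vanishes; being monotone and nonnegative, it vanishes on all of (0, t). Then
k is constant on (0, t), and an arc turning by less than 2π cannot close up. -/
theorem ne_start (h : IsShortIncreasing S Z τ k) {s : ℝ} (hs : s ∈ Ioo 0 S) : Z s ≠ -1 := by
  intro hZ
  obtain ⟨δ, hδ, hδS, hdir⟩ := h.exists_chord_dir
  have hnear : ∀ x ∈ Ioo 0 δ, Z x ≠ -1 := by
    intro x hx hZx
    obtain ⟨ξ, hξ, r, hr, e3, e4⟩ := hdir x hx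
    rw [hZx] at e3 e4
    simp only [Complex.neg_re, Complex.neg_im, Complex.one_re, Complex.one_im] at e3 e4
    have := Real.sin_sq_add_cos_sq (τ ξ)
    have : r = 0 := by
      linear_combination r * (-this) - Real.cos (τ ξ) * e3 - Real.sin (τ ξ) * e4
    exact hr.ne' this
  have hδs : δ ≤ s := by
    by_contra! hlt
    exact hnear s ⟨hs.1, hlt⟩ hZ
  have hcl : IsCompact (Icc δ s ∩ Z ⁻¹' {-1}) := by
    have : IsClosed (Icc δ s ∩ Z ⁻¹' {-1}) :=
      (h.contZ.mono (Icc_subset_Icc hδ.le hs.2.le)).preimage_isClosed_of_isClosed isClosed_Icc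
        isClosed_singleton
    exact isCompact_Icc.of_isClosed_subset this inter_subset_left
  obtain ⟨t, ⟨⟨ht1, ht2⟩, htZ⟩, hmin⟩ := hcl.exists_isLeast ⟨s, ⟨hδs, le_rfl⟩, hZ⟩
  have htI : t ∈ Ioo 0 S := ⟨hδ.trans_le ht1, ht2.trans_lt hs.2⟩
  have hlt : ∀ x ∈ Ioo 0 t, Z x ≠ -1 := by
    intro x hx hZx
    rcases lt_or_ge x δ with hxd | hxd
    · exact hnear x ⟨hx.1, hxd⟩ hZx
    · exact absurd (hmin ⟨⟨hxd, hx.2.le.trans ht2⟩, hZx⟩) (not_le.2 hx.2)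
  have htZ' : Z t = -1 := htZ
  have hot : osc Z τ k (-1) 0 t = 0 := by simp [osc, htZ']
  have hm1 : (⟨-1, 0⟩ : ℂ) = -1 := by apply Complex.ext <;> simp
  have hI : ∀ x ∈ Ioo 0 t, x ∈ Ioo 0 S := fun x hx => ⟨hx.1, hx.2.trans htI.2⟩
  have ho : ∀ x ∈ Ioo 0 t, osc Z τ k (-1) 0 x = 0 := fun x hx =>
    le_antisymm ((h.osc_mono (-1) 0 (hI x hx) htI hx.2.le).trans hot.le) (h.osc_start_nonneg (hI x hx))
  have hk : ∀ x ∈ Ioo 0 t, ∀ y ∈ Ioo 0 t, x ≤ y → k x = k y := fun x hx y hy hxy =>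
    h.k_eq_of_osc_eq (-1) 0 hx.1 hxy (hI y hy).2 (by rw [ho x hx, ho y hy]) fun u hu => by
      rw [hm1]; exact hlt u ⟨hx.1.trans_le hu.1, hu.2.trans_lt hy.2⟩
  have hmid : t / 2 ∈ Ioo 0 t := ⟨by linarith [htI.1], by linarith [htI.1]⟩
  refine h.ne_of_k_const htI (κ := k (t / 2)) (fun x hx => ?_) htZ'
  rcases le_total x (t / 2) with hle | hle
  · exact hk x hx _ hmid hle
  · exact (hk _ hmid x hx hle).symm

theorem ne_end (h : IsShortIncreasing S Z τ k) {s : ℝ} (hs : s ∈ Ioo 0 S) : Z s ≠ 1 := by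
  have := h.reverse.ne_start (s := S - s) ⟨by linarith [hs.2], by linarith [hs.1]⟩
  simpa using this

theorem k_eq_of_osc_start (h : IsShortIncreasing S Z τ k) {s : ℝ} (hs : s ∈ Ioo 0 S)
    (ho : osc Z τ k (-1) 0 s = 0) {x : ℝ} (hx : x ∈ Ioc 0 s) : k x = k s := by
  have hxI : x ∈ Ioo 0 S := ⟨hx.1, hx.2.trans_lt hs.2⟩
  refine h.k_eq_of_osc_eq (-1) 0 hx.1 hx.2 hs.2 (ho.le.trans (h.osc_start_nonneg hxI)) fun u hu => ?_
  have hm1 : (⟨-1, 0⟩ : ℂ) = -1 := by apply Complex.ext <;> simp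
  rw [hm1]
  exact h.ne_start ⟨hx.1.trans_le hu.1, hu.2.trans_lt hs.2⟩

theorem k_eq_of_osc_end (h : IsShortIncreasing S Z τ k) {s : ℝ} (hs : s ∈ Ioo 0 S)
    (ho : osc Z τ k 1 0 s = 0) {x : ℝ} (hx : x ∈ Ico s S) : k x = k s := by
  have := h.reverse.k_eq_of_osc_start (s := S - s) ⟨by linarith [hs.2], by linarith [hs.1]⟩
    (by rw [osc_reverse]; simpa using ho) (x := S - x)
    ⟨by linarith [hx.2], by linarith [hx.1]⟩
  simpa using this

/-- Equality for -1 makes k constant before s, equality for 1 makes it constant after s; both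
together contradict non-constancy. -/
theorem osc_strict (h : IsShortIncreasing S Z τ k) {s : ℝ} (hs : s ∈ Ioo 0 S) :
    0 < osc Z τ k (-1) 0 s ∨ osc Z τ k 1 0 s < 0 := by
  by_contra! hcon
  have h1 := le_antisymm hcon.1 (h.osc_start_nonneg hs)
  have h2 := le_antisymm (h.osc_end_nonpos hs) hcon.2
  have hk : ∀ x ∈ Ioo 0 S, k x = k s := by
    intro x hx
    rcases le_total x s with hle | hle
    · exact h.k_eq_of_osc_start hs h1 ⟨hx.1, hle⟩
    · exact h.k_eq_of_osc_end hs h2 ⟨hle, hx.2⟩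
  obtain ⟨x, hx, y, hy, hne⟩ := h.not_const
  exact hne ((hk x hx).trans (hk y hy).symm)

theorem exists_osc_end_neg (h : IsShortIncreasing S Z τ k) :
    ∃ s ∈ Ioo 0 S, osc Z τ k 1 0 s < 0 := by
  by_contra! hcon
  obtain ⟨x, hx, y, hy, hne⟩ := h.not_const
  have ho : ∀ x ∈ Ioo 0 S, osc Z τ k 1 0 x = 0 := fun x hx =>
    le_antisymm (h.osc_end_nonpos hx) (hcon x hx)
  rcases le_total x y with hle | hle
  · exact hne (h.k_eq_of_osc_end hx (ho x hx) ⟨hle, hy.2⟩).symm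
  · exact hne (h.k_eq_of_osc_end hy (ho y hy) ⟨hle, hx.2⟩)

/-! ### Crossings of the real axis. -/

theorem τ_eq_zero_of_nonneg (h : IsShortIncreasing S Z τ k) {a b : ℝ} (ha : 0 ≤ a) (hb : b ≤ S)
    (hτ : ∀ x ∈ Ioo a b, 0 ≤ τ x) (hab : (Z a).im = (Z b).im) {x : ℝ} (hx : x ∈ Ioo a b) :
    τ x = 0 := by
  have hsub : Icc a b ⊆ Icc 0 S := Icc_subset_Icc ha hb
  have hI : ∀ u ∈ Ioo a b, u ∈ Ioo 0 S := fun u hu => ⟨ha.trans_lt hu.1, hu.2.trans_le hb⟩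
  have hle : ∀ u v, a ≤ u → u ≤ v → v ≤ b → (Z u).im ≤ (Z v).im := by
    intro u v h1 h2 h3
    refine le_of_hasDerivAt_nonneg_off_finset (f := fun u => (Z u).im)
      (f' := fun u => Real.sin (τ u)) ∅ h2
      (h.cont_im.mono ((Icc_subset_Icc h1 h3).trans hsub)) fun w hw _ => ?_
    have hw' : w ∈ Ioo a b := ⟨h1.trans_lt hw.1, hw.2.trans_le h3⟩
    exact ⟨h.deriv_im (hI w hw'), Real.sin_nonneg_of_nonneg_of_le_pi (hτ w hw')
      (h.τ_mem w (hI w hw')).2.le⟩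
  have hconst : ∀ u ∈ Icc a b, (Z u).im = (Z a).im := fun u hu =>
    le_antisymm (hab ▸ hle u b hu.1 hu.2 le_rfl) (hle a u le_rfl hu.1 hu.2)
  have hev : (fun u => (Z u).im) =ᶠ[𝓝 x] fun _ => (Z a).im :=
    Filter.eventuallyEq_of_mem (Ioo_mem_nhds hx.1 hx.2)
      fun u hu => hconst u (Ioo_subset_Icc_self hu)
  have hd : Real.sin (τ x) = 0 := (h.deriv_im (hI x hx)).unique
    ((hasDerivAt_const x _).congr_of_eventuallyEq hev)
  exact (Real.sin_eq_zero_iff_of_lt_of_lt (h.τ_mem x (hI x hx)).1 (h.τ_mem x (hI x hx)).2).1 hd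

theorem k_eq_zero_of_τ_eq_zero (h : IsShortIncreasing S Z τ k) {a b : ℝ} (ha : 0 ≤ a) (hb : b ≤ S)
    (hτ : ∀ x ∈ Ioo a b, τ x = 0) {x : ℝ} (hx : x ∈ Ioo a b) : k x = 0 := by
  obtain ⟨F, hF⟩ := h.derivτ
  have hI : ∀ u ∈ Ioo a b, u ∈ Ioo 0 S := fun u hu => ⟨ha.trans_lt hu.1, hu.2.trans_le hb⟩
  have key : ∀ u ∈ Ioo a b, u ∉ F → k u = 0 := fun u hu huF =>
    (hF u (hI u hu) huF).unique ((hasDerivAt_const u 0).congr_of_eventuallyEq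
      (Filter.eventuallyEq_of_mem (Ioo_mem_nhds hu.1 hu.2) hτ))
  obtain ⟨u, hu, huF⟩ := ((Ioo_infinite hx.1).sdiff F.finite_toSet).nonempty
  obtain ⟨v, hv, hvF⟩ := ((Ioo_infinite hx.2).sdiff F.finite_toSet).nonempty
  have hu' : u ∈ Ioo a b := ⟨hu.1, hu.2.trans hx.2⟩
  have hv' : v ∈ Ioo a b := ⟨hx.1.trans hv.1, hv.2⟩
  have h1 := h.mono (hI u hu') (hI x hx) hu.2.le
  have h2 := h.mono (hI x hx) (hI v hv') hv.1.le
  rw [key u hu' (by simpa using huF)] at h1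
  rw [key v hv' (by simpa using hvF)] at h2
  exact le_antisymm h2 h1

/-- If τ s ≥ 0, then τ ≥ 0 from s on, so Im Z rises from 0 to 0 and the rest is a segment with k =
0. Hence k ≤ 0 throughout and τ decreases to 0, so τ ≥ 0 on the whole curve. The same argument makes
all of it a segment, against non-constancy of k. -/
theorem τ_neg_of_im_eq_zero_of_k_nonneg (h : IsShortIncreasing S Z τ k) {s : ℝ}
    (hs : s ∈ Ioo 0 S) (hk : 0 ≤ k s) (hZ : (Z s).im = 0) : τ s < 0 := by
  by_contra! h0
  have hτ : ∀ x ∈ Ioo s S, 0 ≤ τ x := by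
    intro x hx
    have := h.le_τ_sub (a := s) (b := x) (κ := 0) hs.1.le hx.1.le hx.2.le
      (fun u hu => hk.trans (h.mono hs ⟨hs.1.trans hu.1, hu.2.trans hx.2⟩ hu.1.le))
    linarith
  have hτ0 : ∀ x ∈ Ioo s S, τ x = 0 := fun x hx =>
    h.τ_eq_zero_of_nonneg hs.1.le le_rfl hτ (by rw [hZ, h.Z_end]; simp) hx
  have hk0 : ∀ x ∈ Ioo 0 S, k x ≤ 0 := by
    intro x hx
    have hm : (max x s + S) / 2 ∈ Ioo s S := by
      have h1 := le_max_right x s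
      have h2 : max x s < S := max_lt hx.2 hs.2
      constructor <;> linarith
    have := h.k_eq_zero_of_τ_eq_zero hs.1.le le_rfl hτ0 hm
    rw [← this]
    refine h.mono hx ⟨hs.1.trans hm.1, hm.2⟩ ?_
    have h1 := le_max_left x s
    have h2 := hx.2
    linarith
  have hall : ∀ x ∈ Ioo 0 S, 0 ≤ τ x := by
    intro x hx
    have hm : (max x s + S) / 2 ∈ Ioo s S := by
      have h1 := le_max_right x s
      have h2 : max x s < S := max_lt hx.2 hs.2
      constructor <;> linarith
    have hxm : x ≤ (max x s + S) / 2 := by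
      have h1 := le_max_left x s
      have h2 := hx.2
      linarith
    have := h.τ_sub_le (κ := 0) hx.1.le hxm hm.2.le
      (fun u hu => hk0 u ⟨hx.1.trans hu.1, hu.2.trans hm.2⟩)
    rw [hτ0 _ hm] at this
    linarith
  have hz : ∀ x ∈ Ioo 0 S, τ x = 0 := fun x hx =>
    h.τ_eq_zero_of_nonneg le_rfl le_rfl hall (by rw [h.Z_zero, h.Z_end]; simp) hx
  obtain ⟨x, hx, y, hy, hne⟩ := h.not_const
  exact hne ((h.k_eq_zero_of_τ_eq_zero le_rfl le_rfl hz hx).trans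
    (h.k_eq_zero_of_τ_eq_zero le_rfl le_rfl hz hy).symm)

theorem τ_neg_of_im_eq_zero (h : IsShortIncreasing S Z τ k) {s : ℝ} (hs : s ∈ Ioo 0 S)
    (hZ : (Z s).im = 0) : τ s < 0 := by
  rcases le_total 0 (k s) with hk | hk
  · exact h.τ_neg_of_im_eq_zero_of_k_nonneg hs hk hZ
  · have := h.reverse.τ_neg_of_im_eq_zero_of_k_nonneg (s := S - s)
      ⟨by linarith [hs.2], by linarith [hs.1]⟩ (by simpa using hk) (by simpa using hZ)
    simpa using this

theorem sub_mem {s : ℝ} (hs : s ∈ Ioo 0 S) : S - s ∈ Ioo 0 S :=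
  ⟨by linarith [hs.2], by linarith [hs.1]⟩

theorem start_sq_pos (h : IsShortIncreasing S Z τ k) {s : ℝ} (hs : s ∈ Ioo 0 S) :
    0 < ((Z s).re + 1) ^ 2 + (Z s).im ^ 2 := by
  have : (Z s).re + 1 ≠ 0 ∨ (Z s).im ≠ 0 := by
    by_contra! hcon
    exact h.ne_start hs (Complex.ext (by simpa using eq_neg_of_add_eq_zero_left hcon.1)
      (by simpa using hcon.2))
  rcases this with hh | hh <;> positivity

theorem end_sq_pos (h : IsShortIncreasing S Z τ k) {s : ℝ} (hs : s ∈ Ioo 0 S) :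
    0 < (1 - (Z s).re) ^ 2 + (Z s).im ^ 2 := by
  have : 1 - (Z s).re ≠ 0 ∨ (Z s).im ≠ 0 := by
    by_contra! hcon
    exact h.ne_end hs (Complex.ext (by simpa using (sub_eq_zero.1 hcon.1).symm)
      (by simpa using hcon.2))
  rcases this with hh | hh <;> positivity

/-- The sum is the derivative of arg (1 + Z) - arg (1 - Z). The signs of `osc` at -1 and 1 bound its
terms by k / 2 and -k / 2, and the curvature cancels. -/
theorem slope_neg (h : IsShortIncreasing S Z τ k) {s : ℝ} (hs : s ∈ Ioo 0 S) :
    (Real.sin (τ s) * ((Z s).re + 1) - Real.cos (τ s) * (Z s).im) /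
        (((Z s).re + 1) ^ 2 + (Z s).im ^ 2) +
      (Real.sin (τ s) * (1 - (Z s).re) + Real.cos (τ s) * (Z s).im) /
        ((1 - (Z s).re) ^ 2 + (Z s).im ^ 2) < 0 := by
  have n1 := h.start_sq_pos hs
  have n2 := h.end_sq_pos hs
  have hE := h.osc_start_nonneg hs
  have hD := h.osc_end_nonpos hs
  have hst := h.osc_strict hs
  simp only [osc, sub_neg_eq_add, sub_zero] at hE hD hst
  set X := (Z s).re
  set Y := (Z s).im
  set σ := Real.sin (τ s)
  set γ := Real.cos (τ s)
  rcases hst with hst | hst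
  · have e1 : (σ * (X + 1) - γ * Y) / ((X + 1) ^ 2 + Y ^ 2) < k s / 2 := by
      rw [div_lt_iff₀ n1]; linarith
    have e2 : (σ * (1 - X) + γ * Y) / ((1 - X) ^ 2 + Y ^ 2) ≤ -(k s / 2) := by
      rw [div_le_iff₀ n2]; linarith
    linarith
  · have e1 : (σ * (X + 1) - γ * Y) / ((X + 1) ^ 2 + Y ^ 2) ≤ k s / 2 := by
      rw [div_le_iff₀ n1]; linarith
    have e2 : (σ * (1 - X) + γ * Y) / ((1 - X) ^ 2 + Y ^ 2) < -(k s / 2) := by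
      rw [div_lt_iff₀ n2]; linarith
    linarith

/-- On the real axis the sum in `slope_neg` equals 2 sin τ / (1 - X²) with sin τ < 0. So the axis is
met only between the ends, and the arguments of 1 ± Z never jump. -/
theorem re_sq_lt_one (h : IsShortIncreasing S Z τ k) {s : ℝ} (hs : s ∈ Ioo 0 S)
    (hZ : (Z s).im = 0) : (Z s).re ^ 2 < 1 := by
  have n1 := h.start_sq_pos hs
  have n2 := h.end_sq_pos hs
  have hsl := h.slope_neg hs
  have hτ := h.τ_neg_of_im_eq_zero hs hZ
  have hsin : Real.sin (τ s) < 0 := Real.sin_neg_of_neg_of_neg_pi_lt hτ (h.τ_mem s hs).1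
  rw [hZ] at n1 n2 hsl
  simp only [mul_zero, sub_zero, add_zero, ne_eq, OfNat.ofNat_ne_zero, not_false_eq_true,
    zero_pow] at n1 n2 hsl
  set X := (Z s).re
  have h1 : X + 1 ≠ 0 := fun e => by rw [e] at n1; simp at n1
  have h2 : 1 - X ≠ 0 := fun e => by rw [e] at n2; simp at n2
  have e : Real.sin (τ s) * (X + 1) / (X + 1) ^ 2 + Real.sin (τ s) * (1 - X) / (1 - X) ^ 2 =
      2 * Real.sin (τ s) / (1 - X ^ 2) := by
    have : 1 - X ^ 2 ≠ 0 := by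
      have : 1 - X ^ 2 = (X + 1) * (1 - X) := by ring
      rw [this]; exact mul_ne_zero h1 h2
    field_simp
    ring
  rw [e] at hsl
  by_contra! hge
  have : 0 ≤ 2 * Real.sin (τ s) / (1 - X ^ 2) :=
    div_nonneg_of_nonpos (by linarith) (by linarith)
  linarith

theorem start_mem_slitPlane (h : IsShortIncreasing S Z τ k) {s : ℝ} (hs : s ∈ Ioo 0 S) :
    1 + Z s ∈ Complex.slitPlane := by
  rw [Complex.mem_slitPlane_iff]
  by_cases hZ : (Z s).im = 0
  · left
    have := h.re_sq_lt_one hs hZ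
    simp only [Complex.add_re, Complex.one_re]
    nlinarith
  · right
    simpa using hZ

/-! ### Arguments of 1 ± Z and the bipolar angle. -/

theorem hasDerivAt_arg_start (h : IsShortIncreasing S Z τ k) {s : ℝ} (hs : s ∈ Ioo 0 S) :
    HasDerivAt (fun s => (1 + Z s).arg)
      ((Real.sin (τ s) * ((Z s).re + 1) - Real.cos (τ s) * (Z s).im) /
        (((Z s).re + 1) ^ 2 + (Z s).im ^ 2)) s := by
  have hd := ((h.derivZ s hs).const_add 1).clog_real (h.start_mem_slitPlane hs)
  have := Complex.imCLM.hasFDerivAt.comp_hasDerivAt s hd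
  refine (this.congr_of_eventuallyEq (Eventually.of_forall fun x => by
    simp [Complex.log_im])).congr_deriv ?_
  simp only [Complex.imCLM_apply, Complex.div_im, Complex.exp_ofReal_mul_I_im,
    Complex.exp_ofReal_mul_I_re, Complex.add_re, Complex.add_im, Complex.one_re, Complex.one_im,
    Complex.normSq_apply]
  have : (1 + (Z s).re) * (1 + (Z s).re) + (0 + (Z s).im) * (0 + (Z s).im) =
    ((Z s).re + 1) ^ 2 + (Z s).im ^ 2 := by ring
  rw [this]
  ring

theorem hasDerivAt_arg_end (h : IsShortIncreasing S Z τ k) {s : ℝ} (hs : s ∈ Ioo 0 S) :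
    HasDerivAt (fun s => (1 - Z s).arg)
      (-((Real.sin (τ s) * (1 - (Z s).re) + Real.cos (τ s) * (Z s).im) /
        ((1 - (Z s).re) ^ 2 + (Z s).im ^ 2))) s := by
  have hsub : HasDerivAt (fun s => S - s) (-1) s := by simpa using (hasDerivAt_id s).const_sub S
  have := (h.reverse.hasDerivAt_arg_start (sub_mem hs)).comp s hsub
  simp only [Function.comp_def, sub_sub_cancel, Complex.neg_re, Complex.neg_im] at this
  refine (this.congr_deriv ?_).congr_of_eventuallyEq (Eventually.of_forall fun x => ?_)
  · ring
  · simp only [sub_eq_add_neg]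

theorem tendsto_sub_left : Tendsto (fun s => S - s) (𝓝[<] S) (𝓝[>] 0) := by
  refine tendsto_nhdsWithin_iff.2 ⟨?_, ?_⟩
  · have : Tendsto (fun s => S - s) (𝓝 S) (𝓝 (S - S)) := (continuous_const.sub continuous_id).tendsto S
    rw [sub_self] at this
    exact this.mono_left nhdsWithin_le_nhds
  · filter_upwards [self_mem_nhdsWithin] with s hs
    exact sub_pos.2 (mem_Iio.1 hs)

/-- The argument equals some τ ξ with 0 < ξ < s exactly, so no jump of the branch occurs even for τ
0 = ±π. -/
theorem tendsto_arg_start (h : IsShortIncreasing S Z τ k) :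
    Tendsto (fun s => (1 + Z s).arg) (𝓝[>] 0) (𝓝 (τ 0)) := by
  obtain ⟨δ, hδ, hδS, hdir⟩ := h.exists_chord_dir
  rw [Metric.tendsto_nhdsWithin_nhds]
  intro ε hε
  obtain ⟨δ', hδ', hd⟩ := Metric.continuousOn_iff.1 h.contτ 0 (left_mem_Icc.2 h.S_pos.le) ε hε
  refine ⟨min δ δ', lt_min hδ hδ', fun s hs hsd => ?_⟩
  have hs0 : 0 < s := hs
  rw [Real.dist_eq, sub_zero, abs_of_pos hs0] at hsd
  obtain ⟨ξ, hξ, r, hr, e1, e2⟩ := hdir s ⟨hs, hsd.trans_le (min_le_left _ _)⟩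
  have hsS : s < S := hsd.trans_le ((min_le_left _ _).trans hδS)
  have hξS : ξ ∈ Ioo 0 S := ⟨hξ.1, hξ.2.trans hsS⟩
  have : 1 + Z s = (r : ℂ) * (Complex.cos (τ ξ) + Complex.sin (τ ξ) * Complex.I) := by
    rw [← Complex.ofReal_cos, ← Complex.ofReal_sin]
    apply Complex.ext
    · simp [-Complex.ofReal_cos, -Complex.ofReal_sin]; linarith
    · simp [-Complex.ofReal_cos, -Complex.ofReal_sin]; linarith
  rw [this, Complex.arg_mul_cos_add_sin_mul_I hr
    ⟨(h.τ_mem ξ hξS).1, (h.τ_mem ξ hξS).2.le⟩]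
  refine hd ξ (Ioo_subset_Icc_self hξS) ?_
  rw [Real.dist_eq, sub_zero, abs_of_pos hξ.1]
  exact hξ.2.trans (hsd.trans_le (min_le_right _ _))

theorem nhdsLT_le (h : IsShortIncreasing S Z τ k) : 𝓝[<] S ≤ 𝓝[Icc 0 S] S := by
  rw [← nhdsWithin_Ioo_eq_nhdsLT h.S_pos]
  exact nhdsWithin_mono _ Ioo_subset_Icc_self

theorem nhdsGT_le (h : IsShortIncreasing S Z τ k) : 𝓝[>] 0 ≤ 𝓝[Icc 0 S] (0 : ℝ) := by
  rw [← nhdsWithin_Ioo_eq_nhdsGT h.S_pos]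
  exact nhdsWithin_mono _ Ioo_subset_Icc_self

theorem tendsto_arg_start_left (h : IsShortIncreasing S Z τ k) :
    Tendsto (fun s => (1 + Z s).arg) (𝓝[<] S) (𝓝 0) := by
  have hc : Tendsto Z (𝓝[<] S) (𝓝 1) := by
    have := h.contZ S (right_mem_Icc.2 h.S_pos.le)
    rw [ContinuousWithinAt, h.Z_end] at this
    exact this.mono_left h.nhdsLT_le
  have h2 : (1 + 1 : ℂ) ∈ Complex.slitPlane := by
    rw [Complex.mem_slitPlane_iff]; left; simp
  have := (Complex.continuousAt_arg h2).tendsto.comp (hc.const_add 1)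
  have e : Complex.arg (1 + 1) = 0 := by
    have : (1 + 1 : ℂ) = ((2 : ℝ) : ℂ) := by norm_num
    rw [this, Complex.arg_ofReal_of_nonneg (by norm_num)]
  rwa [e] at this

theorem tendsto_arg_end_left (h : IsShortIncreasing S Z τ k) :
    Tendsto (fun s => (1 - Z s).arg) (𝓝[<] S) (𝓝 (τ S)) := by
  have := h.reverse.tendsto_arg_start.comp (tendsto_sub_left (S := S))
  simpa only [Function.comp_def, sub_sub_cancel, sub_zero, ← sub_eq_add_neg] using this

theorem tendsto_arg_end (h : IsShortIncreasing S Z τ k) :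
    Tendsto (fun s => (1 - Z s).arg) (𝓝[>] 0) (𝓝 0) := by
  have hc : Tendsto Z (𝓝[>] 0) (𝓝 (-1)) := by
    have := h.contZ 0 (left_mem_Icc.2 h.S_pos.le)
    rw [ContinuousWithinAt, h.Z_zero] at this
    exact this.mono_left h.nhdsGT_le
  have h2 : (1 - -1 : ℂ) ∈ Complex.slitPlane := by
    rw [Complex.mem_slitPlane_iff]; left; simp
  have := (Complex.continuousAt_arg h2).tendsto.comp (hc.const_sub 1)
  have e : Complex.arg (1 - -1) = 0 := by
    have : (1 - -1 : ℂ) = ((2 : ℝ) : ℂ) := by norm_num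
    rw [this, Complex.arg_ofReal_of_nonneg (by norm_num)]
  rwa [e] at this

end IsShortIncreasing

/-- The bipolar angle of a point with respect to `±1`: the argument of `(1 + z) / (1 - z)`. -/
noncomputable def bipolar (z : ℂ) : ℝ := (1 + z).arg - (1 - z).arg

namespace IsShortIncreasing

variable {S : ℝ} {Z : ℝ → ℂ} {τ k : ℝ → ℝ}

theorem hasDerivAt_bipolar (h : IsShortIncreasing S Z τ k) {s : ℝ} (hs : s ∈ Ioo 0 S) :
    ∃ d < 0, HasDerivAt (fun s => bipolar (Z s)) d s :=
  ⟨_, by simpa only [sub_neg_eq_add] using h.slope_neg hs,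
    (h.hasDerivAt_arg_start hs).sub (h.hasDerivAt_arg_end hs)⟩

theorem continuousOn_bipolar (h : IsShortIncreasing S Z τ k) :
    ContinuousOn (fun s => bipolar (Z s)) (Ioo 0 S) := fun s hs => by
  obtain ⟨d, _, hd⟩ := h.hasDerivAt_bipolar hs
  exact hd.continuousAt.continuousWithinAt

theorem bipolar_strictAnti (h : IsShortIncreasing S Z τ k) :
    StrictAntiOn (fun s => bipolar (Z s)) (Ioo 0 S) := by
  refine strictAntiOn_of_deriv_neg (convex_Ioo 0 S) h.continuousOn_bipolar fun s hs => ?_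
  rw [interior_Ioo] at hs
  obtain ⟨d, hd0, hd⟩ := h.hasDerivAt_bipolar hs
  rwa [hd.deriv]

theorem tendsto_bipolar (h : IsShortIncreasing S Z τ k) :
    Tendsto (fun s => bipolar (Z s)) (𝓝[>] 0) (𝓝 (τ 0)) := by
  have := h.tendsto_arg_start.sub h.tendsto_arg_end
  rwa [sub_zero] at this

theorem bipolar_lt (h : IsShortIncreasing S Z τ k) {s : ℝ} (hs : s ∈ Ioo 0 S) :
    bipolar (Z s) < τ 0 := by
  have hm : s / 2 ∈ Ioo 0 S := ⟨by linarith [hs.1], by linarith [hs.1, hs.2]⟩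
  refine (h.bipolar_strictAnti hm hs (by linarith [hs.1])).trans_le ?_
  refine ge_of_tendsto h.tendsto_bipolar ?_
  filter_upwards [Ioo_mem_nhdsGT hm.1] with x hx
  exact (h.bipolar_strictAnti ⟨hx.1, hx.2.trans hm.2⟩ hm hx.2).le

theorem bipolar_neg (z : ℂ) : bipolar (-z) = -bipolar z := by
  simp only [bipolar, ← sub_eq_add_neg, sub_neg_eq_add, neg_sub]

theorem lt_bipolar (h : IsShortIncreasing S Z τ k) {s : ℝ} (hs : s ∈ Ioo 0 S) :
    -τ S < bipolar (Z s) := by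
  have := h.reverse.bipolar_lt (sub_mem hs)
  simp only [sub_sub_cancel, bipolar_neg, sub_zero] at this
  linarith

theorem end_angle_sum_pos (h : IsShortIncreasing S Z τ k) : 0 < τ 0 + τ S := by
  have hm : S / 2 ∈ Ioo 0 S := ⟨by linarith [h.S_pos], by linarith [h.S_pos]⟩
  linarith [h.bipolar_lt hm, h.lt_bipolar hm]

/-! ### The tangent circle of least curvature at the start. -/

theorem tendsto_τ_start (h : IsShortIncreasing S Z τ k) : Tendsto τ (𝓝[>] 0) (𝓝 (τ 0)) :=
  (h.contτ 0 (left_mem_Icc.2 h.S_pos.le)).mono_left h.nhdsGT_le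

theorem tendsto_τ_end (h : IsShortIncreasing S Z τ k) : Tendsto τ (𝓝[<] S) (𝓝 (τ S)) :=
  (h.contτ S (right_mem_Icc.2 h.S_pos.le)).mono_left h.nhdsLT_le

/-- The curvature need not have a finite limit at the start. Replacing it by the lower bound κ only
decreases the power term and makes the passage to the limit possible. -/
theorem osc_limit_le (h : IsShortIncreasing S Z τ k) {κ c p q s : ℝ} (hs : s ∈ Ioo 0 S)
    (hκ : ∀ x ∈ Ioo 0 S, κ ≤ k x) (hc : osc Z τ k p q s ≤ c) :
    κ * (((-1 - p) ^ 2 + (0 - q) ^ 2) / 2) +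
      (Real.cos (τ 0) * (0 - q) - Real.sin (τ 0) * (-1 - p)) ≤ c := by
  have hr : Tendsto (fun x => (Z x).re) (𝓝[>] 0) (𝓝 (-1)) := by
    have := (h.cont_re 0 (left_mem_Icc.2 h.S_pos.le)).mono_left h.nhdsGT_le
    simpa [h.Z_zero] using this
  have hi : Tendsto (fun x => (Z x).im) (𝓝[>] 0) (𝓝 0) := by
    have := (h.cont_im 0 (left_mem_Icc.2 h.S_pos.le)).mono_left h.nhdsGT_le
    simpa [h.Z_zero] using this
  have hcos : Tendsto (fun x => Real.cos (τ x)) (𝓝[>] 0) (𝓝 (Real.cos (τ 0))) :=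
    (Real.continuous_cos.tendsto _).comp h.tendsto_τ_start
  have hsin : Tendsto (fun x => Real.sin (τ x)) (𝓝[>] 0) (𝓝 (Real.sin (τ 0))) :=
    (Real.continuous_sin.tendsto _).comp h.tendsto_τ_start
  have hlim := (((((hr.sub_const p).pow 2).add ((hi.sub_const q).pow 2)).div_const 2).const_mul
    κ).add ((hcos.mul (hi.sub_const q)).sub (hsin.mul (hr.sub_const p)))
  refine le_of_tendsto hlim ?_
  filter_upwards [Ioo_mem_nhdsGT hs.1] with x hx
  have hxI : x ∈ Ioo 0 S := ⟨hx.1, hx.2.trans hs.2⟩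
  refine le_trans ?_ ((h.osc_mono p q hxI hs hx.2.le).trans hc)
  simp only [osc]
  have := mul_le_mul_of_nonneg_right (hκ x hxI)
    (by positivity : 0 ≤ (((Z x).re - p) ^ 2 + ((Z x).im - q) ^ 2) / 2)
  linarith

/-- This is the sign of the denominator of b₁: for P = 1 the limit is 2 (κ + sin τ 0), and it lies
below a negative value of `osc`. -/
theorem curv_add_sin_neg (h : IsShortIncreasing S Z τ k) {κ : ℝ}
    (hκ : ∀ x ∈ Ioo 0 S, κ ≤ k x) : κ + Real.sin (τ 0) < 0 := by
  obtain ⟨s, hs, hneg⟩ := h.exists_osc_end_neg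
  have := h.osc_limit_le hs hκ le_rfl (p := 1) (q := 0)
  linarith

/-- The curve lies outside of the circle of the least curvature touching it at the start. -/
theorem start_circle (h : IsShortIncreasing S Z τ k) {κ s : ℝ}
    (hκ : ∀ x ∈ Ioo 0 S, κ ≤ k x) (hs : s ∈ Ioo 0 S) :
    κ * ((((Z s).re + 1) ^ 2 + (Z s).im ^ 2) / 2) ≤
      Real.cos (τ 0) * (Z s).im - Real.sin (τ 0) * ((Z s).re + 1) := by
  -- The fixed point is taken to be Z s itself, whose power at s is zero.
  have := h.osc_limit_le hs hκ (c := 0) (p := (Z s).re) (q := (Z s).im) (by simp [osc])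
  have e : ((-1 - (Z s).re) ^ 2 + (0 - (Z s).im) ^ 2) / 2 =
    (((Z s).re + 1) ^ 2 + (Z s).im ^ 2) / 2 := by ring
  rw [e] at this
  linarith

end IsShortIncreasing

/-! ### The curve in the plane of w = (1 + z) / (1 - z). -/

/-- The ratio of the distances to `-1` and `1`: the modulus of `(1 + z) / (1 - z)`. -/
noncomputable def distRatio (z : ℂ) : ℝ := ‖1 + z‖ / ‖1 - z‖

theorem distRatio_neg (z : ℂ) : distRatio (-z) = (distRatio z)⁻¹ := by
  simp only [distRatio, ← sub_eq_add_neg, sub_neg_eq_add, inv_div]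

/-- Since dw/dz = 2 / (1 - z)², the image curve has the direction τ - 2 arg (1 - z). -/
theorem im_exp_div_sq {z : ℂ} (hz : 1 - z ≠ 0) (θ : ℝ) :
    (Complex.exp (θ * Complex.I) / (1 - z) ^ 2).im =
      Real.sin (θ - 2 * (1 - z).arg) / ‖1 - z‖ ^ 2 := by
  have hb : (‖1 - z‖ : ℂ) ≠ 0 := by simpa using hz
  have e : Complex.exp (θ * Complex.I) / (1 - z) ^ 2 =
      ((1 / ‖1 - z‖ ^ 2 : ℝ) : ℂ) * Complex.exp ((θ - 2 * (1 - z).arg : ℝ) * Complex.I) := by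
    have h1 := Complex.norm_mul_exp_arg_mul_I (1 - z)
    have h2 : ((θ - 2 * (1 - z).arg : ℝ) * Complex.I : ℂ) =
      θ * Complex.I - 2 * ((1 - z).arg * Complex.I) := by push_cast; ring
    rw [h2, Complex.exp_sub, two_mul, Complex.exp_add]
    nth_rewrite 1 [← h1]
    have := Complex.exp_ne_zero ((1 - z).arg * Complex.I)
    push_cast
    field_simp
  rw [e, Complex.im_ofReal_mul, Complex.exp_ofReal_mul_I_im]
  ring

theorem distRatio_mul_exp {z : ℂ} (h2 : 1 - z ≠ 0) :
    (distRatio z : ℂ) * Complex.exp (bipolar z * Complex.I) = (1 + z) / (1 - z) := by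
  have e1 := Complex.norm_mul_exp_arg_mul_I (1 - z)
  have e0 := Complex.norm_mul_exp_arg_mul_I (1 + z)
  have hn : (‖1 - z‖ : ℂ) ≠ 0 := by simpa using h2
  have he := Complex.exp_ne_zero ((1 - z).arg * Complex.I)
  have e2 : (bipolar z * Complex.I : ℂ) = (1 + z).arg * Complex.I - (1 - z).arg * Complex.I := by
    simp only [bipolar]; push_cast; ring
  nth_rewrite 1 [← e1]
  nth_rewrite 1 [← e0]
  rw [e2, Complex.exp_sub, distRatio]
  push_cast
  field_simp

theorem im_exp_mul_bipolar {z : ℂ} (hz : 1 - z ≠ 0) (θ : ℝ) :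
    (Complex.exp (θ * Complex.I) * (2 / (1 - z) - 1)).im =
      distRatio z * Real.sin (bipolar z + θ) := by
  have e : Complex.exp (θ * Complex.I) * (2 / (1 - z) - 1) =
      ((distRatio z : ℝ) : ℂ) * Complex.exp ((bipolar z + θ : ℝ) * Complex.I) := by
    have h1 : 2 / (1 - z) - 1 = (1 + z) / (1 - z) := by field_simp; ring
    rw [h1, ← distRatio_mul_exp hz, mul_left_comm, ← Complex.exp_add]
    push_cast
    ring_nf
  rw [e, Complex.im_ofReal_mul, Complex.exp_ofReal_mul_I_im]

namespace IsShortIncreasing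

variable {S : ℝ} {Z : ℝ → ℂ} {τ k : ℝ → ℝ}

theorem one_sub_ne (h : IsShortIncreasing S Z τ k) {s : ℝ} (hs : s ∈ Ioo 0 S) : 1 - Z s ≠ 0 :=
  fun e => h.ne_end hs (sub_eq_zero.1 e).symm

theorem one_add_ne (h : IsShortIncreasing S Z τ k) {s : ℝ} (hs : s ∈ Ioo 0 S) : 1 + Z s ≠ 0 :=
  fun e => h.ne_start hs (eq_neg_of_add_eq_zero_right e)

theorem distRatio_pos (h : IsShortIncreasing S Z τ k) {s : ℝ} (hs : s ∈ Ioo 0 S) :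
    0 < distRatio (Z s) :=
  div_pos (norm_pos_iff.2 (h.one_add_ne hs)) (norm_pos_iff.2 (h.one_sub_ne hs))

/-- This is `start_circle` in the coordinate exp(iα) / w, in which the tangent circle at the start
is a horizontal line. Replacing z by -z turns w into 1 / w. -/
theorem sin_div_distRatio_le (h : IsShortIncreasing S Z τ k) {κ s : ℝ}
    (hκ : ∀ x ∈ Ioo 0 S, κ ≤ k x) (hs : s ∈ Ioo 0 S) :
    Real.sin (τ 0 - bipolar (Z s)) ≤ distRatio (Z s) * -(κ + Real.sin (τ 0)) := by
  have n1 := h.start_sq_pos hs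
  have hc := h.start_circle hκ hs
  have key : (distRatio (Z s))⁻¹ * Real.sin (τ 0 - bipolar (Z s)) *
      (((Z s).re + 1) ^ 2 + (Z s).im ^ 2) =
      Real.sin (τ 0) * (2 * ((Z s).re + 1) - (((Z s).re + 1) ^ 2 + (Z s).im ^ 2)) -
        2 * Real.cos (τ 0) * (Z s).im := by
    have := im_exp_mul_bipolar (z := -Z s) (by simpa using h.one_add_ne hs) (τ 0)
    rw [bipolar_neg, distRatio_neg, neg_add_eq_sub] at this
    rw [← this]
    simp only [Complex.mul_im, Complex.exp_ofReal_mul_I_im, Complex.exp_ofReal_mul_I_re,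
      Complex.sub_re, Complex.sub_im, Complex.div_re, Complex.div_im, Complex.normSq_apply,
      Complex.neg_re, Complex.neg_im, Complex.one_re, Complex.one_im, Complex.re_ofNat,
      Complex.im_ofNat]
    have e : (1 - -(Z s).re) * (1 - -(Z s).re) + (0 - -(Z s).im) * (0 - -(Z s).im) =
      ((Z s).re + 1) ^ 2 + (Z s).im ^ 2 := by ring
    rw [e]
    field_simp
    ring
  have hR := h.distRatio_pos hs
  have : (distRatio (Z s))⁻¹ * Real.sin (τ 0 - bipolar (Z s)) ≤ -(κ + Real.sin (τ 0)) := by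
    refine le_of_mul_le_mul_right ?_ n1
    rw [key]
    linarith
  rwa [inv_mul_le_iff₀ hR] at this

/-- The direction of the image of the curve under `(1 + z) / (1 - z)` stays on the right of the
ray from the origin. -/
theorem direction_lt (h : IsShortIncreasing S Z τ k) {s : ℝ} (hs : s ∈ Ioo 0 S) :
    τ s - 2 * (1 - Z s).arg < bipolar (Z s) := by
  -- ψ is the direction of the image curve minus its bipolar angle. `slope_neg` gives sin ψ < 0,
  -- which fixes ψ only modulo 2π; the limit 0 at the end selects the branch.
  set ψ : ℝ → ℝ := fun s => τ s - (1 + Z s).arg - (1 - Z s).arg with hψ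
  have hsin : ∀ x ∈ Ioo 0 S, Real.sin (ψ x) < 0 := by
    intro x hx
    have hsl := h.slope_neg hx
    have a0 := norm_pos_iff.2 (h.one_add_ne hx)
    have b0 := norm_pos_iff.2 (h.one_sub_ne hx)
    have c1 := Complex.norm_mul_cos_arg (1 + Z x)
    have s1 := Complex.norm_mul_sin_arg (1 + Z x)
    have c2 := Complex.norm_mul_cos_arg (1 - Z x)
    have s2 := Complex.norm_mul_sin_arg (1 - Z x)
    simp only [Complex.add_re, Complex.add_im, Complex.sub_re, Complex.sub_im, Complex.one_re,
      Complex.one_im, zero_add, zero_sub] at c1 s1 c2 s2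
    set a := ‖1 + Z x‖
    set b := ‖1 - Z x‖
    set A := (1 + Z x).arg
    set B := (1 - Z x).arg
    have n1 : ((Z x).re + 1) ^ 2 + (Z x).im ^ 2 = a ^ 2 := by
      rw [← s1, add_comm (Z x).re, ← c1]
      linear_combination a ^ 2 * Real.sin_sq_add_cos_sq A
    have n2 : (1 - (Z x).re) ^ 2 + (Z x).im ^ 2 = b ^ 2 := by
      rw [← neg_sq (Z x).im, ← s2, ← c2]
      linear_combination b ^ 2 * Real.sin_sq_add_cos_sq B
    have m1 : Real.sin (τ x) * ((Z x).re + 1) - Real.cos (τ x) * (Z x).im =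
        a * Real.sin (τ x - A) := by
      rw [Real.sin_sub, ← s1, add_comm (Z x).re, ← c1]; ring
    have m2 : Real.sin (τ x) * (1 - (Z x).re) + Real.cos (τ x) * (Z x).im =
        b * Real.sin (τ x - B) := by
      rw [Real.sin_sub, ← neg_neg (Z x).im, ← s2, ← c2]; ring
    rw [n1, n2, m1, m2] at hsl
    have e : a * Real.sin (τ x - A) / a ^ 2 + b * Real.sin (τ x - B) / b ^ 2 =
        2 * Real.sin (ψ x) / (a * b) := by
      have f1 : τ x - A = ψ x + B := by simp only [hψ]; ring
      have f2 : τ x - B = ψ x + A := by simp only [hψ]; ring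
      rw [f1, f2, Real.sin_add, Real.sin_add]
      field_simp
      linear_combination Real.sin (ψ x) * (c1 + c2) + Real.cos (ψ x) * (s1 + s2)
    rw [e] at hsl
    by_contra! hge
    have : 0 ≤ 2 * Real.sin (ψ x) / (a * b) := by positivity
    linarith
  have hcont : ContinuousOn ψ (Ioo 0 S) := by
    refine ((h.contτ.mono Ioo_subset_Icc_self).sub fun x hx => ?_).sub fun x hx => ?_
    · exact (h.hasDerivAt_arg_start hx).continuousAt.continuousWithinAt
    · exact (h.hasDerivAt_arg_end hx).continuousAt.continuousWithinAt
  have hlim : Tendsto ψ (𝓝[<] S) (𝓝 0) := by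
    simpa using (h.tendsto_τ_end.sub h.tendsto_arg_start_left).sub h.tendsto_arg_end_left
  have hneg : ψ s < 0 := by
    by_contra! hge
    have hev : ∀ᶠ x in 𝓝[<] S, x ∈ Ioo s S ∧ ψ x ∈ Ioo (-Real.pi) Real.pi :=
      (Filter.Eventually.and (Ioo_mem_nhdsLT hs.2)
        (hlim (Ioo_mem_nhds (by linarith [Real.pi_pos]) Real.pi_pos)))
    obtain ⟨x, hx, hxψ⟩ := hev.exists
    have hxI : x ∈ Ioo 0 S := ⟨hs.1.trans hx.1, hx.2⟩
    have hx0 : ψ x < 0 := by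
      by_contra! hx0
      exact absurd (Real.sin_nonneg_of_nonneg_of_le_pi hx0 hxψ.2.le) (not_le.2 (hsin x hxI))
    obtain ⟨y, hy, hy0⟩ := intermediate_value_Icc' hx.1.le
      (hcont.mono fun y hy => ⟨hs.1.trans_le hy.1, hy.2.trans_lt hx.2⟩) ⟨hx0.le, hge⟩
    have := hsin y ⟨hs.1.trans_le hy.1, hy.2.trans_lt hx.2⟩
    rw [hy0, Real.sin_zero] at this
    exact lt_irrefl _ this
  simp only [hψ] at hneg
  simp only [bipolar]
  linarith

/-- By the sign of `osc` at 1 the image curve only turns to the right, and its direction tends to τ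
S - 2 τ S at the end. -/
theorem le_direction (h : IsShortIncreasing S Z τ k) {s : ℝ} (hs : s ∈ Ioo 0 S) :
    -τ S ≤ τ s - 2 * (1 - Z s).arg := by
  obtain ⟨F, hF⟩ := h.derivτ
  have hlim : Tendsto (fun s => τ s - 2 * (1 - Z s).arg) (𝓝[<] S) (𝓝 (-τ S)) := by
    have := h.tendsto_τ_end.sub (h.tendsto_arg_end_left.const_mul 2)
    convert this using 2
    ring
  refine le_of_tendsto hlim ?_
  filter_upwards [Ioo_mem_nhdsLT hs.2] with y hy
  have hI : ∀ x ∈ Icc s y, x ∈ Ioo 0 S :=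
    fun x hx => ⟨hs.1.trans_le hx.1, hx.2.trans_lt hy.2⟩
  have := le_of_hasDerivAt_nonneg_off_finset (f := fun s => -(τ s - 2 * (1 - Z s).arg))
    (f' := fun s => -(k s - 2 * -((Real.sin (τ s) * (1 - (Z s).re) + Real.cos (τ s) * (Z s).im) /
        ((1 - (Z s).re) ^ 2 + (Z s).im ^ 2)))) F hy.1.le
    (((h.contτ.mono fun x hx => Ioo_subset_Icc_self (hI x hx)).sub
      (continuousOn_const.mul fun x hx =>
        (h.hasDerivAt_arg_end (hI x hx)).continuousAt.continuousWithinAt)).neg)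
    (fun x hx hxF => ?_)
  · linarith
  · have hxI := hI x (Ioo_subset_Icc_self hx)
    refine ⟨((hF x hxI hxF).sub ((h.hasDerivAt_arg_end hxI).const_mul 2)).neg, ?_⟩
    have n2 := h.end_sq_pos hxI
    have hD := h.osc_end_nonpos hxI
    simp only [osc, sub_zero] at hD
    have : (Real.sin (τ x) * (1 - (Z x).re) + Real.cos (τ x) * (Z x).im) /
        ((1 - (Z x).re) ^ 2 + (Z x).im ^ 2) ≤ -(k x / 2) := by
      rw [div_le_iff₀ n2]; linarith
    linarith

/-- At the earlier point t where both u and v equal ω, the circle estimate gives sin ω ≤ -R (κ + sin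
α). From t to s the height R sin v = Im (exp(iβ) w) does not decrease, as the rotated direction of
the image curve stays in [0, ω]. The product of the two estimates is the claim. -/
theorem sin_sq_le (h : IsShortIncreasing S Z τ k) {κ s : ℝ} (hsum : τ 0 + τ S < 2 * Real.pi)
    (hκ : ∀ x ∈ Ioo 0 S, κ ≤ k x) (hs : s ∈ Ioo 0 S)
    (hle : bipolar (Z s) + τ S ≤ omega (τ 0) (τ S)) :
    Real.sin (omega (τ 0) (τ S)) ^ 2 ≤
      distRatio (Z s) * Real.sin (bipolar (Z s) + τ S) * -(κ + Real.sin (τ 0)) := by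
  have hpos := h.end_angle_sum_pos
  set ω := omega (τ 0) (τ S) with hω
  have hω' : ω = (τ 0 + τ S) / 2 := rfl
  have hω0 : 0 < Real.sin ω := Real.sin_pos_of_pos_of_lt_pi (by linarith) (by linarith)
  have hneg := h.curv_add_sin_neg hκ
  obtain ⟨x, hx, hxω⟩ : ∃ x, x ∈ Ioo 0 s ∧ ω - τ S < bipolar (Z x) :=
    (Filter.Eventually.and (Ioo_mem_nhdsGT hs.1)
      (h.tendsto_bipolar (Ioi_mem_nhds (by linarith : ω - τ S < τ 0)))).exists
  have hI : ∀ y ∈ Icc x s, y ∈ Ioo 0 S := fun y hy => ⟨hx.1.trans_le hy.1, hy.2.trans_lt hs.2⟩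
  obtain ⟨t, ht, htω⟩ := intermediate_value_Icc' hx.2.le (h.continuousOn_bipolar.mono hI)
    (show ω - τ S ∈ Icc _ _ from ⟨by linarith, hxω.le⟩)
  simp only at htω
  have htI := hI t ht
  have h1 := h.sin_div_distRatio_le hκ htI
  have e1 : τ 0 - bipolar (Z t) = ω := by rw [htω]; linarith
  rw [e1] at h1
  have hI' : ∀ y ∈ Icc t s, y ∈ Ioo 0 S := fun y hy => hI y ⟨ht.1.trans hy.1, hy.2⟩
  have hd : ∀ y ∈ Ioo 0 S, HasDerivAt
      (fun y => (Complex.exp (τ S * Complex.I) * (2 / (1 - Z y) - 1)).im)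
      (2 * (Real.sin (τ y + τ S - 2 * (1 - Z y).arg) / ‖1 - Z y‖ ^ 2)) y := by
    intro y hy
    have hne := h.one_sub_ne hy
    have := ((((hasDerivAt_const y (2 : ℂ)).div ((h.derivZ y hy).const_sub 1) hne).sub_const
      1).const_mul (Complex.exp (τ S * Complex.I)))
    have := Complex.imCLM.hasFDerivAt.comp_hasDerivAt y this
    refine this.congr_deriv ?_
    rw [← im_exp_div_sq hne]
    have e : Complex.exp (τ S * Complex.I) * ((0 * (1 - Z y) -
        2 * -Complex.exp (τ y * Complex.I)) / (1 - Z y) ^ 2) =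
        ((2 : ℝ) : ℂ) * (Complex.exp ((τ y + τ S : ℝ) * Complex.I) / (1 - Z y) ^ 2) := by
      push_cast
      rw [add_mul, Complex.exp_add]
      ring
    rw [e, Complex.imCLM_apply, Complex.im_ofReal_mul]
  have h2 := le_of_hasDerivAt_nonneg_off_finset ∅ ht.2
    (fun y hy => (hd y (hI' y hy)).continuousAt.continuousWithinAt) (fun y hy _ => by
      have hyI := hI' y (Ioo_subset_Icc_self hy)
      refine ⟨hd y hyI, ?_⟩
      have d1 := h.le_direction hyI
      have d2 := h.direction_lt hyI
      have d3 := h.bipolar_strictAnti htI hyI hy.1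
      simp only at d3
      have := Real.sin_nonneg_of_nonneg_of_le_pi (x := τ y + τ S - 2 * (1 - Z y).arg)
        (by linarith) (by linarith)
      positivity)
  rw [im_exp_mul_bipolar (h.one_sub_ne htI), im_exp_mul_bipolar (h.one_sub_ne hs), htω,
    sub_add_cancel] at h2
  nlinarith [mul_le_mul_of_nonneg_right h2 (by linarith : 0 ≤ -(κ + Real.sin (τ 0))),
    mul_le_mul_of_nonneg_left h1 hω0.le]

theorem distRatio_le (h : IsShortIncreasing S Z τ k) {κ s : ℝ}
    (hκ : ∀ x ∈ Ioo 0 S, k x ≤ κ) (hs : s ∈ Ioo 0 S) :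
    distRatio (Z s) * Real.sin (bipolar (Z s) + τ S) ≤ κ - Real.sin (τ S) := by
  have := h.reverse.sin_div_distRatio_le (κ := -κ)
    (fun x hx => neg_le_neg (hκ _ (sub_mem hx))) (sub_mem hs)
  simp only [sub_sub_cancel, sub_zero, bipolar_neg, distRatio_neg] at this
  rw [sub_neg_eq_add, add_comm (τ S), ← div_eq_inv_mul, le_div_iff₀ (h.distRatio_pos hs)] at this
  linarith

theorem sin_sq_le_end (h : IsShortIncreasing S Z τ k) {κ s : ℝ} (hsum : τ 0 + τ S < 2 * Real.pi)
    (hκ : ∀ x ∈ Ioo 0 S, k x ≤ κ) (hs : s ∈ Ioo 0 S)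
    (hle : τ 0 - bipolar (Z s) ≤ omega (τ 0) (τ S)) :
    Real.sin (omega (τ 0) (τ S)) ^ 2 * distRatio (Z s) ≤
      Real.sin (τ 0 - bipolar (Z s)) * (κ - Real.sin (τ S)) := by
  have hc : omega (τ S) (τ 0) = omega (τ 0) (τ S) := by simp only [omega, add_comm]
  have := h.reverse.sin_sq_le (κ := -κ) (by simpa [add_comm] using hsum)
    (fun x hx => neg_le_neg (hκ _ (sub_mem hx))) (sub_mem hs)
    (by simp only [sub_sub_cancel, sub_zero, sub_self, bipolar_neg, hc]; linarith)
  simp only [sub_sub_cancel, sub_zero, sub_self, bipolar_neg, distRatio_neg, hc] at this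
  rw [mul_assoc, ← div_eq_inv_mul, le_div_iff₀ (h.distRatio_pos hs), neg_add_eq_sub] at this
  linarith

end IsShortIncreasing

/-! ### Circular arcs in the coordinate X = κ cot (κ s / 2). -/

theorem arcPoint_zero_curv (p : ℂ) (θ s : ℝ) :
    arcPoint p θ 0 s = p + s * Complex.exp (θ * Complex.I) := by
  simp [arcPoint]

theorem arcPoint_zero (p : ℂ) (θ κ : ℝ) : arcPoint p θ κ 0 = p := by
  simp [arcPoint]

theorem arcPoint_of_ne_zero (p : ℂ) (θ : ℝ) {κ : ℝ} (hκ : κ ≠ 0) (s : ℝ) :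
    arcPoint p θ κ s = p + Complex.exp (θ * Complex.I) *
      ((Complex.exp ((κ * s : ℝ) * Complex.I) - 1) / (κ * Complex.I)) := by
  have hc : (κ * Complex.I : ℂ) ≠ 0 := mul_ne_zero (by exact_mod_cast hκ) Complex.I_ne_zero
  have hfun : (fun t : ℝ => Complex.exp (((θ + κ * t : ℝ) : ℂ) * Complex.I)) =
      fun t : ℝ => Complex.exp (θ * Complex.I) * Complex.exp ((κ * Complex.I) * t) := by
    funext t
    rw [← Complex.exp_add]
    push_cast
    ring_nf
  rw [arcPoint, hfun, intervalIntegral.integral_const_mul, integral_exp_mul_complex hc]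
  push_cast
  simp only [mul_zero, Complex.exp_zero]
  ring_nf

/-- The length of the arc of curvature `κ` that ends at the point with the
coordinate `X = κ cot (κ s / 2)`. -/
noncomputable def arcLen (κ X : ℝ) : ℝ :=
  if κ = 0 then 2 / X else 2 * Complex.arg ⟨X, κ⟩ / κ

theorem arcLen_pos {κ X : ℝ} (h : κ ≠ 0 ∨ 0 < X) : 0 < arcLen κ X := by
  unfold arcLen
  split_ifs with h0
  · exact div_pos two_pos (h.resolve_left (not_not.2 h0))
  · rcases lt_or_gt_of_ne h0 with hk | hk
    · refine div_pos_of_neg_of_neg ?_ hk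
      linarith [Complex.arg_neg_iff.2 (show (⟨X, κ⟩ : ℂ).im < 0 from hk)]
    · refine div_pos ?_ hk
      have h1 : 0 ≤ Complex.arg ⟨X, κ⟩ := Complex.arg_nonneg_iff.2 hk.le
      have h2 : Complex.arg ⟨X, κ⟩ ≠ 0 := fun e => by
        have := (Complex.arg_eq_zero_iff.1 e).2
        exact hk.ne' this
      have := lt_of_le_of_ne h1 h2.symm
      linarith

theorem mul_arcLen {κ X : ℝ} (hκ : κ ≠ 0) : κ * arcLen κ X = 2 * Complex.arg ⟨X, κ⟩ := by
  rw [arcLen, if_neg hκ]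
  field_simp

theorem abs_arg_lt {κ X : ℝ} (hκ : κ ≠ 0) : |Complex.arg ⟨X, κ⟩| < Real.pi := by
  refine lt_of_le_of_ne (Complex.abs_arg_le_pi _) fun e => ?_
  rcases abs_eq Real.pi_pos.le |>.1 e with e | e
  · exact hκ (Complex.arg_eq_pi_iff.1 e).2
  · exact (Complex.neg_pi_lt_arg _).ne' e

theorem abs_mul_arcLen_lt {κ X : ℝ} (h : κ ≠ 0 ∨ 0 < X) : |κ| * arcLen κ X < 2 * Real.pi := by
  by_cases hκ : κ = 0
  · rw [hκ, abs_zero, zero_mul]; have := Real.pi_pos; positivity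
  · rw [← abs_of_pos (arcLen_pos h), ← abs_mul, mul_arcLen hκ, abs_mul, abs_two]
    linarith [abs_arg_lt (X := X) hκ]

theorem exp_two_arg {z : ℂ} (hz : z ≠ 0) :
    Complex.exp ((2 * z.arg : ℝ) * Complex.I) = z / (starRingEnd ℂ) z := by
  have h1 := Complex.norm_mul_exp_arg_mul_I z
  have hb : (‖z‖ : ℂ) ≠ 0 := by simpa using hz
  have h2 : z * (starRingEnd ℂ) z = (‖z‖ : ℂ) ^ 2 := Complex.mul_conj' z
  have hc : (starRingEnd ℂ) z ≠ 0 := by simpa using hz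
  have e : ((2 * z.arg : ℝ) * Complex.I : ℂ) = z.arg * Complex.I + z.arg * Complex.I := by
    push_cast; ring
  rw [e, Complex.exp_add, eq_div_iff hc]
  apply mul_left_cancel₀ (pow_ne_zero 2 hb)
  calc (‖z‖ : ℂ) ^ 2 * (Complex.exp (z.arg * Complex.I) * Complex.exp (z.arg * Complex.I) *
        (starRingEnd ℂ) z)
      = (‖z‖ * Complex.exp (z.arg * Complex.I)) * (‖z‖ * Complex.exp (z.arg * Complex.I)) *
        (starRingEnd ℂ) z := by ring
    _ = _ := by rw [h1, ← h2]; ring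

theorem conj_mk_eq (X κ : ℝ) : (starRingEnd ℂ) (⟨X, κ⟩ : ℂ) = X - κ * Complex.I := by
  apply Complex.ext <;> simp

theorem mk_eq (X κ : ℝ) : (⟨X, κ⟩ : ℂ) = X + κ * Complex.I := by
  apply Complex.ext <;> simp

theorem sub_mul_I_ne {κ X : ℝ} (h : κ ≠ 0 ∨ 0 < X) : (X - κ * Complex.I : ℂ) ≠ 0 := by
  intro e
  have h1 := congrArg Complex.re e
  have h2 := congrArg Complex.im e
  simp at h1 h2
  rcases h with h | h
  · exact h h2
  · exact h.ne' h1

theorem exp_mul_arcLen {κ X : ℝ} (h : κ ≠ 0 ∨ 0 < X) :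
    Complex.exp ((κ * arcLen κ X : ℝ) * Complex.I) =
      (X + κ * Complex.I) / (X - κ * Complex.I) := by
  by_cases hκ : κ = 0
  · have hX : (X : ℂ) ≠ 0 := by exact_mod_cast (h.resolve_left (not_not.2 hκ)).ne'
    simp [hκ, hX]
  · have hz : (⟨X, κ⟩ : ℂ) ≠ 0 := fun e => hκ (congrArg Complex.im e)
    rw [mul_arcLen hκ, exp_two_arg hz, conj_mk_eq, mk_eq]

/-- Since arg (X + iκ) = κ s / 2, the chord factor (exp(iκ s) - 1) / (iκ) equals 2 / (X - iκ): an
arc is the inverse of a horizontal line run through by X. For κ = 0 this is s = 2 / X. -/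
theorem arcPoint_arcLen {κ X : ℝ} (h : κ ≠ 0 ∨ 0 < X) (p : ℂ) (θ : ℝ) :
    arcPoint p θ κ (arcLen κ X) =
      p + 2 * Complex.exp (θ * Complex.I) / (X - κ * Complex.I) := by
  have hne := sub_mul_I_ne h
  by_cases hκ : κ = 0
  · subst hκ
    rw [arcPoint_zero_curv, arcLen, if_pos rfl]
    push_cast
    ring
  · have hk : (κ : ℂ) ≠ 0 := by exact_mod_cast hκ
    have hI := Complex.I_ne_zero
    rw [arcPoint_of_ne_zero p θ hκ, exp_mul_arcLen h]
    have e : (X + κ * Complex.I : ℂ) / (X - κ * Complex.I) - 1 =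
        2 * (κ * Complex.I) / (X - κ * Complex.I) := by
      rw [div_sub_one hne]
      ring
    rw [e]
    generalize (X - κ * Complex.I : ℂ) = q at hne
    field_simp

theorem exp_add_arcLen {κ X : ℝ} (h : κ ≠ 0 ∨ 0 < X) (θ : ℝ) :
    Complex.exp ((θ + κ * arcLen κ X : ℝ) * Complex.I) =
      Complex.exp (θ * Complex.I) * ((X + κ * Complex.I) / (X - κ * Complex.I)) := by
  rw [← exp_mul_arcLen h, ← Complex.exp_add]
  push_cast
  ring_nf

/-- For κ ≠ 0, sin (arg (X + iκ) - arg (Y + iκ)) has the sign of κ (Y - X), and both arguments lie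
on the same side of the real axis. -/
theorem arcLen_anti {κ X Y : ℝ} (h : κ ≠ 0 ∨ 0 < X) (hXY : X ≤ Y) :
    arcLen κ Y ≤ arcLen κ X := by
  by_cases hκ : κ = 0
  · have hX := h.resolve_left (not_not.2 hκ)
    rw [arcLen, if_pos hκ, arcLen, if_pos hκ]
    exact div_le_div_of_nonneg_left (by norm_num) hX hXY
  have hc : ‖(⟨X, κ⟩ : ℂ)‖ * ‖(⟨Y, κ⟩ : ℂ)‖ *
      Real.sin (Complex.arg ⟨X, κ⟩ - Complex.arg ⟨Y, κ⟩) = κ * (Y - X) := by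
    have c1 := Complex.norm_mul_cos_arg (⟨X, κ⟩ : ℂ)
    have s1 := Complex.norm_mul_sin_arg (⟨X, κ⟩ : ℂ)
    have c2 := Complex.norm_mul_cos_arg (⟨Y, κ⟩ : ℂ)
    have s2 := Complex.norm_mul_sin_arg (⟨Y, κ⟩ : ℂ)
    simp only at c1 s1 c2 s2
    rw [Real.sin_sub]
    calc _ = (‖(⟨X, κ⟩ : ℂ)‖ * Real.sin (Complex.arg ⟨X, κ⟩)) *
          (‖(⟨Y, κ⟩ : ℂ)‖ * Real.cos (Complex.arg ⟨Y, κ⟩)) -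
          (‖(⟨X, κ⟩ : ℂ)‖ * Real.cos (Complex.arg ⟨X, κ⟩)) *
          (‖(⟨Y, κ⟩ : ℂ)‖ * Real.sin (Complex.arg ⟨Y, κ⟩)) := by ring
      _ = _ := by rw [c1, s1, c2, s2]; ring
  have n1 : 0 < ‖(⟨X, κ⟩ : ℂ)‖ := norm_pos_iff.2 fun e => hκ (congrArg Complex.im e)
  have n2 : 0 < ‖(⟨Y, κ⟩ : ℂ)‖ := norm_pos_iff.2 fun e => hκ (congrArg Complex.im e)
  have b1 := abs_lt.1 (abs_arg_lt (X := X) hκ)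
  have b2 := abs_lt.1 (abs_arg_lt (X := Y) hκ)
  rw [arcLen, if_neg hκ, arcLen, if_neg hκ]
  have n3 := mul_pos n1 n2
  rcases lt_or_gt_of_ne hκ with hk | hk
  · have a1 := Complex.arg_neg_iff.2 (show (⟨X, κ⟩ : ℂ).im < 0 from hk)
    have a2 := Complex.arg_neg_iff.2 (show (⟨Y, κ⟩ : ℂ).im < 0 from hk)
    refine div_le_div_of_nonpos_of_le hk.le ?_
    by_contra! hlt
    have := Real.sin_pos_of_pos_of_lt_pi
      (x := Complex.arg ⟨X, κ⟩ - Complex.arg ⟨Y, κ⟩) (by linarith) (by linarith)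
    have := mul_pos n3 this
    nlinarith
  · have a1 := Complex.arg_nonneg_iff.2 (show 0 ≤ (⟨X, κ⟩ : ℂ).im from hk.le)
    have a2 := Complex.arg_nonneg_iff.2 (show 0 ≤ (⟨Y, κ⟩ : ℂ).im from hk.le)
    refine div_le_div_of_nonneg_right ?_ hk.le
    by_contra! hlt
    have := Real.sin_neg_of_neg_of_neg_pi_lt
      (x := Complex.arg ⟨X, κ⟩ - Complex.arg ⟨Y, κ⟩) (by linarith) (by linarith)
    have := mul_neg_of_pos_of_neg n3 this
    nlinarith

/-! ### Existence and parametrization of biarcs. -/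

section Biarc

variable {α β b : ℝ}

/-- A straight first piece must not pass through infinity. If its curvature vanishes, then α < 0,
and sin (ω - α) is sin ω times the coordinate in question, with 0 < ω - α < π. -/
theorem biarcCurv₁_or (hα : |α| ≤ Real.pi) (hβ : |β| ≤ Real.pi) (hω0 : 0 < omega α β)
    (hωπ : omega α β < Real.pi) (hb : 0 < b) :
    biarcCurv₁ b α β ≠ 0 ∨ 0 < Real.cos α + Real.cos (omega α β) / b := by
  rw [or_iff_not_imp_left, not_not]
  intro h0
  have hω : omega α β = (α + β) / 2 := rfl
  have hs : 0 < Real.sin (omega α β) := Real.sin_pos_of_pos_of_lt_pi hω0 hωπ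
  have e : Real.sin α = -(Real.sin (omega α β) / b) := by
    rw [biarcCurv₁] at h0
    rw [div_eq_inv_mul]
    linarith
  have hneg : Real.sin α < 0 := by
    rw [e]; exact neg_neg_of_pos (div_pos hs hb)
  have hα' := abs_le.1 hα
  have hβ' := abs_le.1 hβ
  have hα0 : α < 0 := by
    by_contra! hge
    exact absurd (Real.sin_nonneg_of_nonneg_of_le_pi hge hα'.2) (not_le.2 hneg)
  have hαπ : -Real.pi < α := lt_of_le_of_ne hα'.1 fun e => by
    rw [← e, Real.sin_neg, Real.sin_pi, neg_zero] at hneg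
    exact lt_irrefl _ hneg
  have hpos : 0 < Real.sin (omega α β - α) :=
    Real.sin_pos_of_pos_of_lt_pi (by linarith) (by linarith)
  rw [Real.sin_sub, e] at hpos
  refine pos_of_mul_pos_right (a := Real.sin (omega α β)) ?_ hs.le
  calc 0 < _ := hpos
    _ = _ := by ring

theorem biarcCurv₂_or (hα : |α| ≤ Real.pi) (hβ : |β| ≤ Real.pi) (hω0 : 0 < omega α β)
    (hωπ : omega α β < Real.pi) (hb : 0 < b) :
    biarcCurv₂ b α β ≠ 0 ∨ 0 < Real.cos β + b * Real.cos (omega α β) := by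
  have hc : omega β α = omega α β := by simp only [omega, add_comm]
  have := biarcCurv₁_or (b := b⁻¹) hβ hα (hc ▸ hω0) (hc ▸ hωπ) (inv_pos.2 hb)
  rw [biarcCurv₁, hc, inv_inv, div_inv_eq_mul, mul_comm _ b] at this
  refine this.imp_left fun h e => h ?_
  rw [biarcCurv₂] at e
  linarith

/-- The biarc as the image of an arc of a circle and a ray under `w ↦ (w - 1) / (w + 1)`. -/
theorem exists_biarc (hα : |α| ≤ Real.pi) (hβ : |β| ≤ Real.pi) (hω0 : 0 < omega α β)
    (hωπ : omega α β < Real.pi) (hb : 0 < b) :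
    ∃ ℓ₁ ℓ₂ : ℝ, 0 < ℓ₁ ∧ 0 < ℓ₂ ∧
      |biarcCurv₁ b α β| * ℓ₁ < 2 * Real.pi ∧ |biarcCurv₂ b α β| * ℓ₂ < 2 * Real.pi ∧
      arcPoint (arcPoint (-1) α (biarcCurv₁ b α β) ℓ₁) (α + biarcCurv₁ b α β * ℓ₁)
        (biarcCurv₂ b α β) ℓ₂ = 1 ∧
      Complex.exp (((α + biarcCurv₁ b α β * ℓ₁ + biarcCurv₂ b α β * ℓ₂ : ℝ) : ℂ) * Complex.I)
        = Complex.exp ((β : ℂ) * Complex.I) ∧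
      (∀ X, Real.cos α + Real.cos (omega α β) / b ≤ X → ∃ s ∈ Icc 0 ℓ₁,
        arcPoint (-1) α (biarcCurv₁ b α β) s =
          -1 + 2 * Complex.exp (α * Complex.I) / (X - biarcCurv₁ b α β * Complex.I)) ∧
      (∀ t : ℝ, 0 ≤ t → ∃ s ∈ Icc 0 ℓ₂,
        arcPoint (arcPoint (-1) α (biarcCurv₁ b α β) ℓ₁) (α + biarcCurv₁ b α β * ℓ₁)
          (biarcCurv₂ b α β) s =
          1 - 2 / (1 + Complex.exp (((-β : ℝ) : ℂ) * Complex.I) *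
            (b * Complex.exp (omega α β * Complex.I) + t))) := by
  have h1 := biarcCurv₁_or hα hβ hω0 hωπ hb
  have h2 := biarcCurv₂_or hα hβ hω0 hωπ hb
  set κ₁ := biarcCurv₁ b α β with hκ₁
  set κ₂ := biarcCurv₂ b α β with hκ₂
  set ω := omega α β with hω
  have hω' : ω = (α + β) / 2 := rfl
  -- The first arc reaches the joint w = b exp(iδ) at the coordinate X₁, the second one reaches 1 at
  -- X₂. With D and W the boundary directions are W D and W / D, and all identities become rational.
  set X₁ := Real.cos α + Real.cos ω / b with hX₁
  set X₂ := Real.cos β + b * Real.cos ω with hX₂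
  set δ := (α - β) / 2 with hδ
  set D := Complex.exp (δ * Complex.I) with hD
  set W := Complex.exp (ω * Complex.I) with hW
  have D0 : D ≠ 0 := Complex.exp_ne_zero _
  have W0 : W ≠ 0 := Complex.exp_ne_zero _
  have b0 : (b : ℂ) ≠ 0 := by exact_mod_cast hb.ne'
  have eα : Complex.exp (α * Complex.I) = W * D := by
    rw [hW, hD, ← Complex.exp_add, hω', hδ]; push_cast; ring_nf
  have eβ : Complex.exp (β * Complex.I) = W / D := by
    rw [hW, hD, ← Complex.exp_sub, hω', hδ]; push_cast; ring_nf
  have enβ : Complex.exp (((-β : ℝ) : ℂ) * Complex.I) = D / W := by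
    rw [hW, hD, ← Complex.exp_sub, hω', hδ]; push_cast; ring_nf
  have enα : Complex.exp (((-α : ℝ) : ℂ) * Complex.I) = (W * D)⁻¹ := by
    rw [← eα, ← Complex.exp_neg]; push_cast; ring_nf
  have enω : Complex.exp (((-ω : ℝ) : ℂ) * Complex.I) = W⁻¹ := by
    rw [hW, ← Complex.exp_neg]; push_cast; ring_nf
  have cs : ∀ θ : ℝ, Complex.exp (θ * Complex.I) = (Real.cos θ : ℂ) + (Real.sin θ : ℂ) * Complex.I :=
    fun θ => by rw [Complex.exp_mul_I, Complex.ofReal_cos, Complex.ofReal_sin]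
  have m1 : (X₁ - κ₁ * Complex.I : ℂ) = W * D + W / b := by
    rw [← eα, hW, cs α, cs ω, hX₁, hκ₁, biarcCurv₁]
    push_cast
    ring
  have p1 : (X₁ + κ₁ * Complex.I : ℂ) = (W * D)⁻¹ + W⁻¹ / b := by
    rw [← enα, ← enω, cs, cs, Real.cos_neg, Real.cos_neg, Real.sin_neg, Real.sin_neg, hX₁, hκ₁,
      biarcCurv₁]
    push_cast
    ring
  have m2 : (X₂ - κ₂ * Complex.I : ℂ) = (D + b) / W := by
    rw [add_div, ← enβ, div_eq_mul_inv, ← enω, cs, cs, Real.cos_neg, Real.cos_neg, Real.sin_neg,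
      Real.sin_neg, hX₂, hκ₂, biarcCurv₂]
    push_cast
    ring
  have p2 : (X₂ + κ₂ * Complex.I : ℂ) = W / D + b * W := by
    rw [← eβ, hW, cs, cs, hX₂, hκ₂, biarcCurv₂]
    push_cast
    ring
  have ne1 := sub_mul_I_ne h1
  have ne2 := sub_mul_I_ne h2
  have nJ : (b * D + 1 : ℂ) ≠ 0 := by
    intro e
    apply ne1
    rw [m1]
    have : W * D + W / b = W / b * (b * D + 1) := by field_simp
    rw [this, e, mul_zero]
  have nJ' : (D + b : ℂ) ≠ 0 := by
    intro e
    apply ne2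
    rw [m2, e, zero_div]
  have hJ : arcPoint (-1) α κ₁ (arcLen κ₁ X₁) = 1 - 2 / (1 + b * D) := by
    rw [arcPoint_arcLen h1, m1, eα]
    have e : W * D + W / b = W * (1 + b * D) / b := by
      field_simp
      ring
    have hj : (1 + b * D : ℂ) ≠ 0 := by rwa [add_comm]
    have e2 : (-1 + 2 * (W * D) / (W * (1 + b * D) / b) : ℂ) =
        ((1 + b * D) - 2) / (1 + b * D) := by
      rw [div_div_eq_mul_div, eq_div_iff hj, add_mul, div_mul_eq_mul_div,
        show (2 * (W * D) * b * (1 + b * D) : ℂ) = 2 * D * b * (W * (1 + b * D)) by ring,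
        mul_div_assoc, div_self (mul_ne_zero W0 hj)]
      ring
    rw [e, e2, sub_div, div_self hj]
  have hθ : Complex.exp (((α + κ₁ * arcLen κ₁ X₁ : ℝ) : ℂ) * Complex.I) =
      (b + D) / (W * (b * D + 1)) := by
    rw [exp_add_arcLen h1, m1, p1, eα]
    have : (D * b + 1 : ℂ) ≠ 0 := by rwa [mul_comm]
    field_simp
  have nJ2 : (1 + b * D : ℂ) ≠ 0 := by rwa [add_comm]
  have nJ2' : (b + D : ℂ) ≠ 0 := by rwa [add_comm]
  refine ⟨arcLen κ₁ X₁, arcLen κ₂ X₂, arcLen_pos h1, arcLen_pos h2, abs_mul_arcLen_lt h1,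
    abs_mul_arcLen_lt h2, ?_, ?_, ?_, ?_⟩
  · rw [arcPoint_arcLen h2, hθ, hJ, m2]
    field_simp
    ring
  · rw [exp_add_arcLen h2, hθ, m2, p2, eβ]
    field_simp
    ring
  · intro X hX
    exact ⟨arcLen κ₁ X, ⟨(arcLen_pos (h1.imp_right fun h => h.trans_le hX)).le, arcLen_anti h1 hX⟩,
      arcPoint_arcLen (h1.imp_right fun h => h.trans_le hX) _ _⟩
  · intro t ht
    rcases ht.eq_or_lt with rfl | ht
    · refine ⟨0, left_mem_Icc.2 (arcLen_pos h2).le, ?_⟩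
      rw [arcPoint_zero, hJ, enβ]
      congr 3
      push_cast
      field_simp
      ring
    -- N = |1 + b exp(iδ)|². The ray parameter t > 0 corresponds to the coordinate X = N / t + X₂; t
    -- = 0 is the joint, where X is infinite.
    · set N : ℝ := 1 + 2 * b * Real.cos δ + b ^ 2 with hN
      have N0 : 0 ≤ N := by
        have := Real.neg_one_le_cos δ
        have : N = (1 - b) ^ 2 + 2 * b * (1 + Real.cos δ) := by rw [hN]; ring
        rw [this]
        have : 0 ≤ 1 + Real.cos δ := by linarith
        positivity
      have eN : (N : ℂ) = (b * D + 1) * (b + D) / D := by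
        have e2 : (2 * Real.cos δ : ℂ) = D + D⁻¹ := by
          have : D⁻¹ = Complex.exp (((-δ : ℝ) : ℂ) * Complex.I) := by
            rw [hD, ← Complex.exp_neg]; push_cast; ring_nf
          rw [this, hD, cs, cs, Real.cos_neg, Real.sin_neg]
          push_cast
          ring
        have : (N : ℂ) = 1 + b * (2 * Real.cos δ) + b ^ 2 := by rw [hN]; push_cast; ring
        rw [this, e2]
        field_simp
        ring
      have hX : X₂ ≤ N / t + X₂ := by
        have : 0 ≤ N / t := by positivity
        linarith
      have h3 := h2.imp_right fun h => h.trans_le hX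
      refine ⟨arcLen κ₂ (N / t + X₂), ⟨(arcLen_pos h3).le, arcLen_anti h2 hX⟩, ?_⟩
      have t0 : (t : ℂ) ≠ 0 := by exact_mod_cast ht.ne'
      have m3 : (((N / t + X₂ : ℝ) : ℂ) - κ₂ * Complex.I) =
          (D + b) * (W * (b * D + 1) + D * t) / (W * D * t) := by
        have : (((N / t + X₂ : ℝ) : ℂ) - κ₂ * Complex.I) = N / t + (X₂ - κ₂ * Complex.I) := by
          push_cast; ring
        rw [this, m2, eN]
        field_simp
        ring
      have ne3 := sub_mul_I_ne h3
      rw [m3] at ne3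
      have ne4 : (W * (b * D + 1) + D * t : ℂ) ≠ 0 := fun e => ne3 (by rw [e]; simp)
      rw [arcPoint_arcLen h3, hθ, hJ, m3, enβ]
      have e5 : (1 + D / W * (b * W + t) : ℂ) = (W * (b * D + 1) + D * t) / W := by
        field_simp
        ring
      rw [e5]
      field_simp
      ring

end Biarc

/-! ### Points on biarcs, and reflection in the real axis. -/

section Membership

variable {α β b : ℝ}

/-- On the first arc exp(iα) / w = exp(iu) / R has the constant height sin ω / b, which determines
b. The condition u ≤ ω puts the point before the joint. -/
theorem mem_finiteBiarc_of_first (hα : |α| ≤ Real.pi) (hβ : |β| ≤ Real.pi) (hω0 : 0 < omega α β)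
    (hωπ : omega α β < Real.pi) {z : ℂ} (h1 : 1 + z ≠ 0) (h2 : 1 - z ≠ 0)
    (hu0 : 0 < α - bipolar z) (hu : α - bipolar z ≤ omega α β) :
    z ∈ finiteBiarc (distRatio z * Real.sin (omega α β) / Real.sin (α - bipolar z)) α β := by
  have hs : 0 < Real.sin (omega α β) := Real.sin_pos_of_pos_of_lt_pi hω0 hωπ
  have hsu : 0 < Real.sin (α - bipolar z) := Real.sin_pos_of_pos_of_lt_pi hu0 (by linarith)
  have hR : 0 < distRatio z := div_pos (norm_pos_iff.2 h1) (norm_pos_iff.2 h2)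
  set u := α - bipolar z with hudef
  set R := distRatio z with hRdef
  set b := R * Real.sin (omega α β) / Real.sin u with hb
  have hb0 : 0 < b := by positivity
  obtain ⟨ℓ₁, ℓ₂, p1, p2, q1, q2, e1, e2, hfst, -⟩ := exists_biarc hα hβ hω0 hωπ hb0
  have hsb : Real.sin (omega α β) / b = Real.sin u / R := by
    rw [hb]; field_simp
  have hX : Real.cos α + Real.cos (omega α β) / b ≤ Real.cos α + Real.cos u / R := by
    have := Real.sin_nonneg_of_nonneg_of_le_pi (x := omega α β - u) (by linarith) (by linarith)
    rw [Real.sin_sub] at this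
    have : Real.cos (omega α β) / b ≤ Real.cos u / R := by
      rw [hb, div_div_eq_mul_div, div_le_div_iff₀ (by positivity) hR]
      nlinarith
    linarith
  obtain ⟨s, hs, hseq⟩ := hfst _ hX
  refine ⟨ℓ₁, ℓ₂, p1, p2, q1, q2, e1, e2, Or.inl ⟨s, hs, ?_⟩⟩
  have hw := distRatio_mul_exp h2
  rw [← hRdef] at hw
  have hR' : (R : ℂ) ≠ 0 := by exact_mod_cast hR.ne'
  have hden : ((Real.cos α + Real.cos u / R : ℝ) : ℂ) - biarcCurv₁ b α β * Complex.I =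
      Complex.exp (α * Complex.I) * (2 / (1 + z)) := by
    have cs : ∀ θ : ℝ, Complex.exp (θ * Complex.I) =
        (Real.cos θ : ℂ) + (Real.sin θ : ℂ) * Complex.I :=
      fun θ => by rw [Complex.exp_mul_I, Complex.ofReal_cos, Complex.ofReal_sin]
    have e3 : ((Real.cos α + Real.cos u / R : ℝ) : ℂ) - biarcCurv₁ b α β * Complex.I =
        Complex.exp (α * Complex.I) + Complex.exp (u * Complex.I) / R := by
      have : biarcCurv₁ b α β = -(Real.sin α + Real.sin u / R) := by
        rw [← hsb, biarcCurv₁]; ring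
      rw [this, cs, cs]
      push_cast
      ring
    have e4 : (u * Complex.I : ℂ) = α * Complex.I - bipolar z * Complex.I := by
      rw [hudef]; push_cast; ring
    rw [e3, e4, Complex.exp_sub]
    have : Complex.exp (α * Complex.I) / Complex.exp (bipolar z * Complex.I) / R =
        Complex.exp (α * Complex.I) / ((1 + z) / (1 - z)) := by
      rw [← hw, div_div, mul_comm (R : ℂ)]
    rw [this]
    field_simp
    ring
  rw [hseq, hden]
  have := Complex.exp_ne_zero (α * Complex.I)
  field_simp
  ring

/-- The point exp(iβ) w = R exp(iv) must lie on the ray b exp(iω) + t. Equal heights determine b,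
and v ≤ ω gives t ≥ 0. -/
theorem mem_finiteBiarc_of_second (hα : |α| ≤ Real.pi) (hβ : |β| ≤ Real.pi)
    (hω0 : 0 < omega α β) (hωπ : omega α β < Real.pi) {z : ℂ} (h1 : 1 + z ≠ 0) (h2 : 1 - z ≠ 0)
    (hv0 : 0 < bipolar z + β) (hv : bipolar z + β ≤ omega α β) :
    z ∈ finiteBiarc (distRatio z * Real.sin (bipolar z + β) / Real.sin (omega α β)) α β := by
  have hs : 0 < Real.sin (omega α β) := Real.sin_pos_of_pos_of_lt_pi hω0 hωπ
  have hsv : 0 < Real.sin (bipolar z + β) := Real.sin_pos_of_pos_of_lt_pi hv0 (by linarith)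
  have hR : 0 < distRatio z := div_pos (norm_pos_iff.2 h1) (norm_pos_iff.2 h2)
  set v := bipolar z + β with hvdef
  set R := distRatio z with hRdef
  set b := R * Real.sin v / Real.sin (omega α β) with hb
  have hb0 : 0 < b := by positivity
  obtain ⟨ℓ₁, ℓ₂, p1, p2, q1, q2, e1, e2, -, hsnd⟩ := exists_biarc hα hβ hω0 hωπ hb0
  have hbs : b * Real.sin (omega α β) = R * Real.sin v := by
    rw [hb]; field_simp
  have ht : 0 ≤ R * Real.cos v - b * Real.cos (omega α β) := by
    have := Real.sin_nonneg_of_nonneg_of_le_pi (x := omega α β - v) (by linarith) (by linarith)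
    rw [Real.sin_sub] at this
    have e : R * Real.cos v - b * Real.cos (omega α β) =
        R * (Real.sin (omega α β) * Real.cos v - Real.cos (omega α β) * Real.sin v) /
          Real.sin (omega α β) := by
      rw [hb]; field_simp
    rw [e]
    positivity
  obtain ⟨s, hs, hseq⟩ := hsnd _ ht
  refine ⟨ℓ₁, ℓ₂, p1, p2, q1, q2, e1, e2, Or.inr ⟨s, hs, ?_⟩⟩
  have hw := distRatio_mul_exp h2
  rw [← hRdef] at hw
  have hcore : Complex.exp (((-β : ℝ) : ℂ) * Complex.I) *
      (b * Complex.exp (omega α β * Complex.I) +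
        ((R * Real.cos v - b * Real.cos (omega α β) : ℝ) : ℂ)) = (1 + z) / (1 - z) := by
    have cs : ∀ θ : ℝ, Complex.exp (θ * Complex.I) =
        (Real.cos θ : ℂ) + (Real.sin θ : ℂ) * Complex.I :=
      fun θ => by rw [Complex.exp_mul_I, Complex.ofReal_cos, Complex.ofReal_sin]
    have e3 : (b * Complex.exp (omega α β * Complex.I) +
        ((R * Real.cos v - b * Real.cos (omega α β) : ℝ) : ℂ)) =
        R * Complex.exp (v * Complex.I) := by
      rw [cs, cs]
      have : (b * Real.sin (omega α β) : ℂ) = R * Real.sin v := by exact_mod_cast hbs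
      push_cast at this ⊢
      linear_combination Complex.I * this
    rw [e3, ← hw, mul_left_comm, ← Complex.exp_add]
    congr 2
    rw [hvdef]
    push_cast
    ring
  rw [hseq, hcore]
  field_simp
  ring

theorem neg_one_mem_finiteBiarc (hα : |α| ≤ Real.pi) (hβ : |β| ≤ Real.pi)
    (hω0 : 0 < omega α β) (hωπ : omega α β < Real.pi) (hb : 0 < b) :
    (-1 : ℂ) ∈ finiteBiarc b α β := by
  obtain ⟨ℓ₁, ℓ₂, p1, p2, q1, q2, e1, e2, -, -⟩ := exists_biarc hα hβ hω0 hωπ hb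
  exact ⟨ℓ₁, ℓ₂, p1, p2, q1, q2, e1, e2,
    Or.inl ⟨0, left_mem_Icc.2 p1.le, (arcPoint_zero _ _ _).symm⟩⟩

theorem one_mem_finiteBiarc (hα : |α| ≤ Real.pi) (hβ : |β| ≤ Real.pi)
    (hω0 : 0 < omega α β) (hωπ : omega α β < Real.pi) (hb : 0 < b) :
    (1 : ℂ) ∈ finiteBiarc b α β := by
  obtain ⟨ℓ₁, ℓ₂, p1, p2, q1, q2, e1, e2, -, -⟩ := exists_biarc hα hβ hω0 hωπ hb
  exact ⟨ℓ₁, ℓ₂, p1, p2, q1, q2, e1, e2, Or.inr ⟨ℓ₂, right_mem_Icc.2 p2.le, e1.symm⟩⟩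

theorem biarc_coe (hb : 0 < b) : biarc (b : EReal) α β = finiteBiarc b α β := by
  have h0 : (b : EReal) ≠ 0 := by exact_mod_cast hb.ne'
  rw [biarc, if_neg h0, if_neg (by simp), EReal.toReal_coe]

theorem finiteBiarc_subset_bilense {b₁ b₂ : EReal} (hb : 0 < b) (h1 : b₁ ≤ b) (h2 : b ≤ b₂) :
    finiteBiarc b α β ⊆ bilense α β b₁ b₂ :=
  fun _ hz => ⟨b, h1, h2, by rwa [biarc_coe hb]⟩

theorem conj_arcPoint (p : ℂ) (θ κ s : ℝ) :
    (starRingEnd ℂ) (arcPoint p θ κ s) = arcPoint ((starRingEnd ℂ) p) (-θ) (-κ) s := by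
  rw [arcPoint, arcPoint, map_add]
  congr 1
  have hc : Continuous fun t : ℝ => Complex.exp (((θ + κ * t : ℝ) : ℂ) * Complex.I) := by fun_prop
  have := (Complex.conjCLE : ℂ ≃L[ℝ] ℂ).toContinuousLinearMap.intervalIntegral_comp_comm
    (hc.intervalIntegrable (μ := MeasureTheory.volume) 0 s)
  refine Eq.trans this.symm (intervalIntegral.integral_congr fun t _ => ?_)
  change (starRingEnd ℂ) (Complex.exp _) = _
  rw [← Complex.exp_conj, map_mul, Complex.conj_ofReal, Complex.conj_I]
  push_cast
  ring_nf

theorem omega_neg (α β : ℝ) : omega (-α) (-β) = -omega α β := by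
  simp only [omega]; ring

theorem biarcCurv₁_neg (b α β : ℝ) : biarcCurv₁ b (-α) (-β) = -biarcCurv₁ b α β := by
  simp only [biarcCurv₁, omega_neg, Real.sin_neg]; ring

theorem biarcCurv₂_neg (b α β : ℝ) : biarcCurv₂ b (-α) (-β) = -biarcCurv₂ b α β := by
  simp only [biarcCurv₂, omega_neg, Real.sin_neg]; ring

theorem conj_mem_finiteBiarc {z : ℂ} (hz : z ∈ finiteBiarc b α β) :
    (starRingEnd ℂ) z ∈ finiteBiarc b (-α) (-β) := by
  obtain ⟨ℓ₁, ℓ₂, p1, p2, q1, q2, e1, e2, hmem⟩ := hz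
  have hm1 : (-1 : ℂ) = (starRingEnd ℂ) (-1) := by simp
  have hang : ∀ κ ℓ : ℝ, -α + -κ * ℓ = -(α + κ * ℓ) := fun κ ℓ => by ring
  refine ⟨ℓ₁, ℓ₂, p1, p2, ?_, ?_, ?_, ?_, ?_⟩
  · rwa [biarcCurv₁_neg, abs_neg]
  · rwa [biarcCurv₂_neg, abs_neg]
  · rw [biarcCurv₁_neg, biarcCurv₂_neg, hang, hm1, ← conj_arcPoint, ← conj_arcPoint, e1, map_one]
  · have := congrArg (starRingEnd ℂ) e2
    rw [← Complex.exp_conj, ← Complex.exp_conj, map_mul, map_mul, Complex.conj_ofReal,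
      Complex.conj_ofReal, Complex.conj_I] at this
    rw [biarcCurv₁_neg, biarcCurv₂_neg]
    convert this using 2
    · push_cast; ring
    · push_cast; ring
  · rw [biarcCurv₁_neg, biarcCurv₂_neg, hang, hm1]
    rcases hmem with ⟨s, hs, rfl⟩ | ⟨s, hs, rfl⟩
    · exact Or.inl ⟨s, hs, conj_arcPoint _ _ _ _⟩
    · exact Or.inr ⟨s, hs, by rw [conj_arcPoint, conj_arcPoint]⟩

end Membership

/-! ### The bilense parameters, and the choice of a biarc through each point. -/

theorem bilenseParam₁_coe (α β κ : ℝ) : bilenseParam₁ α β (κ : EReal) =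
    ((-Real.sin (omega α β) / (κ + Real.sin α) : ℝ) : EReal) := by
  rw [bilenseParam₁, ← EReal.coe_add, ← EReal.coe_div]

theorem bilenseParam₂_coe (α β κ : ℝ) : bilenseParam₂ α β (κ : EReal) =
    (((κ - Real.sin β) / Real.sin (omega α β) : ℝ) : EReal) := by
  rw [bilenseParam₂, ← EReal.coe_sub, ← EReal.coe_div]

theorem bilenseParam₁_bot (α β : ℝ) : bilenseParam₁ α β ⊥ = 0 := by
  rw [bilenseParam₁, EReal.bot_add, EReal.div_bot]

theorem bilenseParam₁_top (α β : ℝ) : bilenseParam₁ α β ⊤ = 0 := by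
  rw [bilenseParam₁, EReal.top_add_coe, EReal.div_top]

theorem bilenseParam₁_neg (α β : ℝ) (κ : EReal) :
    bilenseParam₁ (-α) (-β) (-κ) = bilenseParam₁ α β κ := by
  induction κ with
  | bot => rw [EReal.neg_bot, bilenseParam₁_bot, bilenseParam₁_top]
  | top => rw [EReal.neg_top, bilenseParam₁_bot, bilenseParam₁_top]
  | coe κ =>
    rw [← EReal.coe_neg, bilenseParam₁_coe, bilenseParam₁_coe, omega_neg, Real.sin_neg,
      Real.sin_neg, ← neg_add, div_neg, neg_neg, neg_div]

theorem bilenseParam₂_neg (α β : ℝ) (κ : EReal) :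
    bilenseParam₂ (-α) (-β) (-κ) = bilenseParam₂ α β κ := by
  rw [bilenseParam₂, bilenseParam₂, omega_neg, Real.sin_neg, Real.sin_neg]
  have e : -κ - ((-Real.sin β : ℝ) : EReal) = -(κ - ((Real.sin β : ℝ) : EReal)) := by
    rw [EReal.neg_sub (Or.inr (EReal.coe_ne_bot _)) (Or.inr (EReal.coe_ne_top _)), EReal.coe_neg,
      sub_eq_add_neg, neg_neg]
  rw [e, EReal.div_eq_inv_mul, EReal.div_eq_inv_mul, ← EReal.coe_inv, ← EReal.coe_inv, inv_neg,
    EReal.coe_neg, neg_mul_neg]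

namespace IsShortIncreasing

variable {S : ℝ} {Z : ℝ → ℂ} {τ k : ℝ → ℝ}

/-- Since u + v = 2ω, one of the two angles is at most ω, and this decides which arc carries the
point. In each case one bound is the tangent circle estimate at one end and the other is the
transported estimate from the opposite end. -/
theorem exists_param (h : IsShortIncreasing S Z τ k) (hsum : τ 0 + τ S < 2 * Real.pi)
    {s : ℝ} (hs : s ∈ Ioo 0 S) :
    ∃ b : ℝ, 0 < b ∧ Z s ∈ finiteBiarc b (τ 0) (τ S) ∧
      (∀ κ : ℝ, (∀ x ∈ Ioo 0 S, κ ≤ k x) →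
        -Real.sin (omega (τ 0) (τ S)) / (κ + Real.sin (τ 0)) ≤ b) ∧
      (∀ κ : ℝ, (∀ x ∈ Ioo 0 S, k x ≤ κ) →
        b ≤ (κ - Real.sin (τ S)) / Real.sin (omega (τ 0) (τ S))) := by
  have hα : |τ 0| ≤ Real.pi := abs_le.2 (h.τ_mem_Icc (left_mem_Icc.2 h.S_pos.le))
  have hβ : |τ S| ≤ Real.pi := abs_le.2 (h.τ_mem_Icc (right_mem_Icc.2 h.S_pos.le))
  have hpos := h.end_angle_sum_pos
  have hω : omega (τ 0) (τ S) = (τ 0 + τ S) / 2 := rfl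
  have hω0 : 0 < omega (τ 0) (τ S) := by linarith
  have hωπ : omega (τ 0) (τ S) < Real.pi := by linarith
  have hsω : 0 < Real.sin (omega (τ 0) (τ S)) := Real.sin_pos_of_pos_of_lt_pi hω0 hωπ
  have h1 := h.one_add_ne hs
  have h2 := h.one_sub_ne hs
  have hR := h.distRatio_pos hs
  have hu0 : 0 < τ 0 - bipolar (Z s) := by linarith [h.bipolar_lt hs]
  have hv0 : 0 < bipolar (Z s) + τ S := by linarith [h.lt_bipolar hs]
  rcases le_total (bipolar (Z s) + τ S) (omega (τ 0) (τ S)) with hv | hv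
  · have hsv : 0 < Real.sin (bipolar (Z s) + τ S) :=
      Real.sin_pos_of_pos_of_lt_pi hv0 (by linarith)
    refine ⟨_, by positivity, mem_finiteBiarc_of_second hα hβ hω0 hωπ h1 h2 hv0 hv,
      fun κ hκ => ?_, fun κ hκ => ?_⟩
    · have hneg := h.curv_add_sin_neg hκ
      have := h.sin_sq_le hsum hκ hs hv
      rw [← neg_div_neg_eq, neg_neg, div_le_div_iff₀ (by linarith) hsω]
      linarith
    · exact div_le_div_of_nonneg_right (h.distRatio_le hκ hs) hsω.le
  · have hu : τ 0 - bipolar (Z s) ≤ omega (τ 0) (τ S) := by linarith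
    have hsu : 0 < Real.sin (τ 0 - bipolar (Z s)) :=
      Real.sin_pos_of_pos_of_lt_pi hu0 (by linarith)
    refine ⟨_, by positivity, mem_finiteBiarc_of_first hα hβ hω0 hωπ h1 h2 hu0 hu,
      fun κ hκ => ?_, fun κ hκ => ?_⟩
    · have hneg := h.curv_add_sin_neg hκ
      have := h.sin_div_distRatio_le hκ hs
      rw [← neg_div_neg_eq, neg_neg, div_le_div_iff₀ (by linarith) hsu]
      nlinarith [mul_le_mul_of_nonneg_left this hsω.le]
    · have := h.sin_sq_le_end hsum hκ hs hu
      rw [div_le_div_iff₀ hsu hsω]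
      linarith

theorem exists_mem_finiteBiarc (h : IsShortIncreasing S Z τ k) (hsum : τ 0 + τ S < 2 * Real.pi)
    {κ₁ κ₂ : EReal} (hκ : ∀ s ∈ Ioo 0 S, κ₁ ≤ ((k s : ℝ) : EReal) ∧ ((k s : ℝ) : EReal) ≤ κ₂) :
    0 ≤ bilenseParam₁ (τ 0) (τ S) κ₁ ∧ ∀ s ∈ Icc 0 S, ∃ b : ℝ, 0 < b ∧
      bilenseParam₁ (τ 0) (τ S) κ₁ ≤ b ∧ b ≤ bilenseParam₂ (τ 0) (τ S) κ₂ ∧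
      Z s ∈ finiteBiarc b (τ 0) (τ S) := by
  have hα : |τ 0| ≤ Real.pi := abs_le.2 (h.τ_mem_Icc (left_mem_Icc.2 h.S_pos.le))
  have hβ : |τ S| ≤ Real.pi := abs_le.2 (h.τ_mem_Icc (right_mem_Icc.2 h.S_pos.le))
  have hpos := h.end_angle_sum_pos
  have hω : omega (τ 0) (τ S) = (τ 0 + τ S) / 2 := rfl
  have hω0 : 0 < omega (τ 0) (τ S) := by linarith
  have hωπ : omega (τ 0) (τ S) < Real.pi := by linarith
  have hsω : 0 < Real.sin (omega (τ 0) (τ S)) := Real.sin_pos_of_pos_of_lt_pi hω0 hωπ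
  have hm : S / 2 ∈ Ioo 0 S := ⟨by linarith [h.S_pos], by linarith [h.S_pos]⟩
  have hint : ∀ s ∈ Ioo 0 S, ∃ b : ℝ, 0 < b ∧
      bilenseParam₁ (τ 0) (τ S) κ₁ ≤ b ∧ b ≤ bilenseParam₂ (τ 0) (τ S) κ₂ ∧
      Z s ∈ finiteBiarc b (τ 0) (τ S) := by
    intro s hs
    obtain ⟨b, hb, hmem, hlow, hupp⟩ := h.exists_param hsum hs
    refine ⟨b, hb, ?_, ?_, hmem⟩
    · induction κ₁ with
      | bot => rw [bilenseParam₁_bot]; exact_mod_cast hb.le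
      | top => rw [bilenseParam₁_top]; exact_mod_cast hb.le
      | coe κ =>
        rw [bilenseParam₁_coe]
        exact_mod_cast hlow κ fun x hx => by exact_mod_cast (hκ x hx).1
    · induction κ₂ with
      | bot => exact absurd (hκ _ hm).2 (by simp)
      | top =>
        rw [bilenseParam₂, EReal.top_sub_coe, EReal.top_div_of_pos_ne_top
          (by exact_mod_cast hsω) (EReal.coe_ne_top _)]
        exact le_top
      | coe κ =>
        rw [bilenseParam₂_coe]
        exact_mod_cast hupp κ fun x hx => by exact_mod_cast (hκ x hx).2
  refine ⟨?_, fun s hs => ?_⟩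
  · induction κ₁ with
    | bot => rw [bilenseParam₁_bot]
    | top => rw [bilenseParam₁_top]
    | coe κ =>
      have hneg := h.curv_add_sin_neg (κ := κ) fun x hx => by exact_mod_cast (hκ x hx).1
      rw [bilenseParam₁_coe]
      exact_mod_cast div_nonneg_of_nonpos (by linarith) hneg.le
  -- The ends lie on every biarc, so the parameter of an interior point serves for them.
  · obtain ⟨b, hb, h1, h2, -⟩ := hint _ hm
    rcases hs.1.eq_or_lt with rfl | h0
    · exact ⟨b, hb, h1, h2, h.Z_zero ▸ neg_one_mem_finiteBiarc hα hβ hω0 hωπ hb⟩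
    rcases hs.2.eq_or_lt with rfl | hS
    · exact ⟨b, hb, h1, h2, h.Z_end ▸ one_mem_finiteBiarc hα hβ hω0 hωπ hb⟩
    exact hint s ⟨h0, hS⟩

end IsShortIncreasing

/-! ### Reduction of a general spiral to the normalized increasing case. -/

namespace Spiral

/-- Shortness means exp(iτ) ≠ -1, so the interval of interior values of τ avoids ±π. If it lay
beyond one of them, then both boundary angles would equal that value by continuity, and |ω| would be
π. -/
theorem τ_mem_Ioo (C : Spiral) {c : ℝ} (hnorm : C.IsNormalized c) (hshort : C.IsShort)
    (h0 : |C.τ 0| ≤ Real.pi) (hS : |C.τ C.S| ≤ Real.pi)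
    (hω : |omega (C.τ 0) (C.τ C.S)| ≠ Real.pi) {s : ℝ} (hs : s ∈ Ioo 0 C.S) :
    C.τ s ∈ Ioo (-Real.pi) Real.pi := by
  obtain ⟨hc, hZ0, hZS⟩ := hnorm
  have hne : ∀ x ∈ Ioo 0 C.S, Complex.exp ((C.τ x : ℂ) * Complex.I) ≠ -1 := by
    intro x hx e
    refine hshort x hx (1 / (2 * c)) (by positivity) ?_
    have hc' : (c : ℂ) ≠ 0 := by exact_mod_cast hc.ne'
    rw [e, hZ0, hZS]
    push_cast
    field_simp
    ring
  have hneπ : ∀ x ∈ Ioo 0 C.S, C.τ x ≠ Real.pi := fun x hx e =>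
    hne x hx (by rw [e, Complex.exp_pi_mul_I])
  have hneπ' : ∀ x ∈ Ioo 0 C.S, C.τ x ≠ -Real.pi := fun x hx e =>
    hne x hx (by rw [e]; push_cast; rw [neg_mul, Complex.exp_neg, Complex.exp_pi_mul_I]; norm_num)
  have hpre : IsPreconnected (C.τ '' Ioo 0 C.S) :=
    isPreconnected_Ioo.image _ (C.continuousOn_τ.mono Ioo_subset_Icc_self)
  have hord := hpre.ordConnected
  have hcl : closure (Ioo 0 C.S) = Icc 0 C.S := closure_Ioo C.S_pos.ne
  have hbd : ∀ K : Set ℝ, IsClosed K → MapsTo C.τ (Ioo 0 C.S) K → C.τ 0 ∈ K ∧ C.τ C.S ∈ K := by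
    intro K hK hm
    have := hm.closure_of_continuousOn (by rw [hcl]; exact C.continuousOn_τ)
    rw [hcl, hK.closure_eq] at this
    exact ⟨this (left_mem_Icc.2 C.S_pos.le), this (right_mem_Icc.2 C.S_pos.le)⟩
  have h0' := abs_le.1 h0
  have hS' := abs_le.1 hS
  constructor
  · by_contra! hle
    have hlow : MapsTo C.τ (Ioo 0 C.S) (Iic (-Real.pi)) := by
      intro x hx
      by_contra! hgt
      obtain ⟨y, hy, hyπ⟩ := hord.out (mem_image_of_mem _ hs) (mem_image_of_mem _ hx)
        ⟨hle, le_of_not_ge hgt⟩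
      exact hneπ' y hy hyπ
    obtain ⟨e0, eS⟩ := hbd _ isClosed_Iic hlow
    rw [mem_Iic] at e0 eS
    apply hω
    have : omega (C.τ 0) (C.τ C.S) = -Real.pi := by
      rw [omega]; linarith [h0'.1, hS'.1]
    rw [this, abs_neg, abs_of_pos Real.pi_pos]
  · by_contra! hge
    have hupp : MapsTo C.τ (Ioo 0 C.S) (Ici Real.pi) := by
      intro x hx
      by_contra! hlt
      obtain ⟨y, hy, hyπ⟩ := hord.out (mem_image_of_mem _ hx) (mem_image_of_mem _ hs)
        ⟨le_of_not_ge hlt, hge⟩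
      exact hneπ y hy hyπ
    obtain ⟨e0, eS⟩ := hbd _ isClosed_Ici hupp
    rw [mem_Ici] at e0 eS
    apply hω
    have : omega (C.τ 0) (C.τ C.S) = Real.pi := by
      rw [omega]; linarith [h0'.2, hS'.2]
    rw [this, abs_of_pos Real.pi_pos]

theorem isShortIncreasing (C : Spiral) {c : ℝ} (hnorm : C.IsNormalized c) (hinc : C.IsIncreasing)
    (hτ : ∀ s ∈ Ioo 0 C.S, C.τ s ∈ Ioo (-Real.pi) Real.pi) :
    IsShortIncreasing (C.S / c) (fun s => C.Z (c * s) / c) (fun s => C.τ (c * s))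
      (fun s => c * C.k (c * s)) := by
  obtain ⟨hc, hZ0, hZS⟩ := hnorm
  have hc' : (c : ℂ) ≠ 0 := by exact_mod_cast hc.ne'
  have hI : ∀ s ∈ Ioo 0 (C.S / c), c * s ∈ Ioo 0 C.S := fun s hs =>
    ⟨mul_pos hc hs.1, by rw [mul_comm]; exact (lt_div_iff₀ hc).1 hs.2⟩
  have hI' : ∀ s ∈ Ioo 0 C.S, s / c ∈ Ioo 0 (C.S / c) := fun s hs =>
    ⟨div_pos hs.1 hc, (div_lt_div_iff_of_pos_right hc).2 hs.2⟩
  have hM : MapsTo (fun s => c * s) (Icc 0 (C.S / c)) (Icc 0 C.S) := fun s hs =>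
    ⟨mul_nonneg hc.le hs.1, by
      change c * s ≤ C.S
      rw [mul_comm]; exact (le_div_iff₀ hc).1 hs.2⟩
  have hcont : ContinuousOn (fun s => c * s) (Icc 0 (C.S / c)) := by fun_prop
  have hd : ∀ s : ℝ, HasDerivAt (fun s => c * s) c s := fun s => by
    simpa using (hasDerivAt_id s).const_mul c
  refine ⟨div_pos C.S_pos hc, ?_, C.continuousOn_τ.comp hcont hM, ?_, ?_, ?_, ?_, ?_, ?_,
    fun s hs => hτ _ (hI s hs)⟩
  · exact (C.continuousOn_Z.comp hcont hM).div_const _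
  · intro s hs
    refine (((C.hasDerivAt_Z _ (hI s hs)).scomp s (hd s)).div_const (c : ℂ)).congr_deriv ?_
    rw [Complex.real_smul]
    field_simp
  · obtain ⟨F, hF⟩ := C.piecewise
    refine ⟨F.image (fun s => s / c), fun s hs hsF => ?_⟩
    have : c * s ∉ F := fun hm => hsF (Finset.mem_image.2 ⟨c * s, hm, by field_simp⟩)
    exact ((hF _ (hI s hs) this).2.comp s (hd s)).congr_deriv (mul_comm _ _)
  · intro s hs t ht hst
    exact mul_le_mul_of_nonneg_left
      (hinc (hI s hs) (hI t ht) (mul_le_mul_of_nonneg_left hst hc.le)) hc.le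
  · obtain ⟨s, hs, t, ht, hne⟩ := C.not_const
    refine ⟨s / c, hI' s hs, t / c, hI' t ht, fun e => hne ?_⟩
    simp only [mul_div_cancel₀ _ hc.ne'] at e
    exact mul_left_cancel₀ hc.ne' e
  · simp only [mul_zero, hZ0]
    field_simp
  · simp only [mul_div_cancel₀ _ hc.ne', hZS]
    field_simp

/-- The mirror image of a spiral in the real axis. -/
noncomputable def mirror (C : Spiral) : Spiral where
  S := C.S
  Z := fun s => (starRingEnd ℂ) (C.Z s)
  τ := fun s => -C.τ s
  k := fun s => -C.k s
  S_pos := C.S_pos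
  continuousOn_Z := Complex.continuous_conj.comp_continuousOn C.continuousOn_Z
  continuousOn_τ := C.continuousOn_τ.neg
  hasDerivAt_Z := fun s hs => by
    have := (Complex.conjCLE : ℂ ≃L[ℝ] ℂ).toContinuousLinearMap.hasFDerivAt.comp_hasDerivAt s
      (C.hasDerivAt_Z s hs)
    refine this.congr_deriv ?_
    change (starRingEnd ℂ) (Complex.exp _) = _
    rw [← Complex.exp_conj, map_mul, Complex.conj_ofReal, Complex.conj_I]
    push_cast
    ring_nf
  piecewise := by
    obtain ⟨F, hF⟩ := C.piecewise
    exact ⟨F, fun s hs hsF => ⟨(hF s hs hsF).1.neg, (hF s hs hsF).2.neg⟩⟩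
  monotonic := C.monotonic.symm.imp (fun h => h.neg) (fun h => h.neg)
  not_const := by
    obtain ⟨s, hs, t, ht, hne⟩ := C.not_const
    exact ⟨s, hs, t, ht, fun e => hne (neg_injective e)⟩
  no_circle := by
    rintro ⟨p, r, hr, hsub⟩
    refine C.no_circle ⟨(starRingEnd ℂ) p, r, hr, fun z hz => ?_⟩
    have hz' : (starRingEnd ℂ) z ∈ Metric.sphere p r := by
      rw [mem_sphere_iff_norm] at hz ⊢
      rw [← hz, ← Complex.norm_conj (z - _), map_sub, Complex.conj_conj]
    obtain ⟨s, hs, hseq⟩ := hsub hz'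
    exact ⟨s, hs, (starRingEnd ℂ).injective hseq⟩

theorem IsNormalized.mirror {C : Spiral} {c : ℝ} (h : C.IsNormalized c) :
    C.mirror.IsNormalized c := by
  obtain ⟨hc, hZ0, hZS⟩ := h
  refine ⟨hc, ?_, ?_⟩
  · change (starRingEnd ℂ) (C.Z 0) = _
    rw [hZ0, map_neg, Complex.conj_ofReal]
  · change (starRingEnd ℂ) (C.Z C.S) = _
    rw [hZS, Complex.conj_ofReal]

theorem bilense_of_increasing (C : Spiral) {c : ℝ} {κ₁ κ₂ : EReal} (hnorm : C.IsNormalized c)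
    (hinc : C.IsIncreasing) (hτ : ∀ s ∈ Ioo 0 C.S, C.τ s ∈ Ioo (-Real.pi) Real.pi)
    (hω : |omega (C.τ 0) (C.τ C.S)| ≠ Real.pi)
    (hκ : ∀ s ∈ Ioo 0 C.S, κ₁ ≤ ((c * C.k s : ℝ) : EReal) ∧ ((c * C.k s : ℝ) : EReal) ≤ κ₂) :
    0 ≤ bilenseParam₁ (C.τ 0) (C.τ C.S) κ₁ ∧ ∀ s ∈ Icc 0 C.S, ∃ b : ℝ, 0 < b ∧
      bilenseParam₁ (C.τ 0) (C.τ C.S) κ₁ ≤ b ∧ b ≤ bilenseParam₂ (C.τ 0) (C.τ C.S) κ₂ ∧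
      C.Z s / c ∈ finiteBiarc b (C.τ 0) (C.τ C.S) := by
  have hc := hnorm.1
  have h := C.isShortIncreasing hnorm hinc hτ
  have e0 : C.τ (c * 0) = C.τ 0 := by rw [mul_zero]
  have eS : C.τ (c * (C.S / c)) = C.τ C.S := by rw [mul_div_cancel₀ _ hc.ne']
  have t0 := h.τ_mem_Icc (left_mem_Icc.2 h.S_pos.le)
  have tS := h.τ_mem_Icc (right_mem_Icc.2 h.S_pos.le)
  simp only [e0, eS] at t0 tS
  have hsum : C.τ 0 + C.τ C.S < 2 * Real.pi := by
    refine lt_of_le_of_ne (by linarith [t0.2, tS.2]) fun e => hω ?_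
    have : omega (C.τ 0) (C.τ C.S) = Real.pi := by rw [omega]; linarith
    rw [this, abs_of_pos Real.pi_pos]
  have := h.exists_mem_finiteBiarc (κ₁ := κ₁) (κ₂ := κ₂) (by rw [e0, eS]; exact hsum)
    (fun s hs => hκ _ ⟨mul_pos hc hs.1, by rw [mul_comm]; exact (lt_div_iff₀ hc).1 hs.2⟩)
  rw [e0, eS] at this
  refine ⟨this.1, fun s hs => ?_⟩
  have hs' := this.2 (s / c) ⟨div_nonneg hs.1 hc.le, div_le_div_of_nonneg_right hs.2 hc.le⟩
  rwa [mul_div_cancel₀ _ hc.ne'] at hs'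

end Spiral

end SpiralGeometry

theorem theorem7p4 (α β : ℝ) (hα : |α| ≤ Real.pi) (hβ : |β| ≤ Real.pi)
    (hω : |SpiralGeometry.omega α β| ≠ Real.pi) (κ₁ κ₂ : EReal)
    (C : SpiralGeometry.Spiral) (c : ℝ) (hnorm : C.IsNormalized c) (hshort : C.IsShort)
    (hstart : C.τ 0 = α) (hend : C.τ C.S = β)
    (hκ : (C.IsIncreasing ∧ ∀ s ∈ Set.Ioo 0 C.S,
            κ₁ ≤ ((c * C.k s : ℝ) : EReal) ∧ ((c * C.k s : ℝ) : EReal) ≤ κ₂) ∨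
          (C.IsDecreasing ∧ ∀ s ∈ Set.Ioo 0 C.S,
            ((c * C.k s : ℝ) : EReal) ≤ κ₁ ∧ κ₂ ≤ ((c * C.k s : ℝ) : EReal))) :
    0 ≤ SpiralGeometry.bilenseParam₁ α β κ₁ ∧
    SpiralGeometry.bilenseParam₁ α β κ₁ ≤ SpiralGeometry.bilenseParam₂ α β κ₂ ∧
    ∀ s ∈ Set.Icc 0 C.S, C.Z s / (c : ℂ) ∈
      SpiralGeometry.bilense α β (SpiralGeometry.bilenseParam₁ α β κ₁)
        (SpiralGeometry.bilenseParam₂ α β κ₂) := by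
  subst hstart hend
  have hτ : ∀ s ∈ Set.Ioo 0 C.S, C.τ s ∈ Set.Ioo (-Real.pi) Real.pi :=
    fun s hs => C.τ_mem_Ioo hnorm hshort hα hβ hω hs
  suffices hmain : 0 ≤ SpiralGeometry.bilenseParam₁ (C.τ 0) (C.τ C.S) κ₁ ∧
      ∀ s ∈ Set.Icc 0 C.S, ∃ b : ℝ, 0 < b ∧
        SpiralGeometry.bilenseParam₁ (C.τ 0) (C.τ C.S) κ₁ ≤ b ∧
        b ≤ SpiralGeometry.bilenseParam₂ (C.τ 0) (C.τ C.S) κ₂ ∧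
        C.Z s / c ∈ SpiralGeometry.finiteBiarc b (C.τ 0) (C.τ C.S) by
    obtain ⟨h0, hall⟩ := hmain
    refine ⟨h0, ?_, fun s hs => ?_⟩
    -- The order of b₁ and b₂ follows because the parameter of any point of the curve lies between
    -- them.
    · obtain ⟨b, -, h1, h2, -⟩ := hall 0 (Set.left_mem_Icc.2 C.S_pos.le)
      exact h1.trans h2
    · obtain ⟨b, hb, h1, h2, hmem⟩ := hall s hs
      exact SpiralGeometry.finiteBiarc_subset_bilense hb h1 h2 hmem
  rcases hκ with ⟨hinc, hκ⟩ | ⟨hdec, hκ⟩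
  · exact C.bilense_of_increasing hnorm hinc hτ hω hκ
  -- Complex conjugation negates angles and curvatures and leaves b₁ and b₂ unchanged, so the
  -- decreasing case is the mirror image of the increasing one.
  · have h := C.mirror.bilense_of_increasing (κ₁ := -κ₁) (κ₂ := -κ₂) hnorm.mirror
      (AntitoneOn.neg hdec) (fun s hs => ⟨neg_lt_neg (hτ s hs).2, neg_lt.1 (hτ s hs).1⟩)
      (by
        change |SpiralGeometry.omega (-C.τ 0) (-C.τ C.S)| ≠ _
        rwa [SpiralGeometry.omega_neg, abs_neg])
      (fun s hs => by
        change -κ₁ ≤ ((c * -C.k s : ℝ) : EReal) ∧ ((c * -C.k s : ℝ) : EReal) ≤ -κ₂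
        rw [mul_neg, EReal.coe_neg, EReal.neg_le_neg_iff, EReal.neg_le_neg_iff]
        exact hκ s hs)
    change 0 ≤ SpiralGeometry.bilenseParam₁ (-C.τ 0) (-C.τ C.S) (-κ₁) ∧
      ∀ s ∈ Set.Icc 0 C.S, ∃ b : ℝ, 0 < b ∧
        SpiralGeometry.bilenseParam₁ (-C.τ 0) (-C.τ C.S) (-κ₁) ≤ b ∧
        b ≤ SpiralGeometry.bilenseParam₂ (-C.τ 0) (-C.τ C.S) (-κ₂) ∧
        (starRingEnd ℂ) (C.Z s) / c ∈
          SpiralGeometry.finiteBiarc b (-C.τ 0) (-C.τ C.S) at h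
    rw [SpiralGeometry.bilenseParam₁_neg, SpiralGeometry.bilenseParam₂_neg] at h
    refine ⟨h.1, fun s hs => ?_⟩
    obtain ⟨b, hb, h1, h2, hmem⟩ := h.2 s hs
    refine ⟨b, hb, h1, h2, ?_⟩
    simpa using SpiralGeometry.conj_mem_finiteBiarc hmem
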